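/- Let $n\ge 2$. For $L=(l_1,\dots,l_n)$ with all $l_i>0$ let $M^0(L)$ be the moduli space of the planar robot arm with edge lengths $L$, i.e. the set of all $(n+1)$-tuples $R=(r_0,\dots,r_n)$ of points of $\mathbb R^2$ with $|r_{i-1}r_i|=l_i$ for $i=1,\dots,n$, $r_0=(0,0)$ and $r_1=(l_1,0)$; it is parametrized by the direction angles of the edges $r_{1}r_2,\dots,r_{n-1}r_n$ and so is a torus $(S^1)^{n-1}$. The oriented area of $R$, with $r_i=(x_i,y_i)$, is the smooth function on $M^0(L)$ given by $2A(R)=(x_0y_1-x_1y_0)+\dots+(x_{n-1}y_n-x_ny_{n-1})+(x_ny_0-x_0y_n)$. Call $L$ generic if all critical points of $A$ on $M^0(L)$ are non-degenerate and for no critical point $R$ does the line through an edge $r_{i-1}r_i$ contain the midpoint $O$ of $r_0r_n$. (i) The generic length vectors form an open dense subset of the set of all $L\in\mathbb R^n$ with positive entries. (ii) Let $L$ be generic and let $R$ be a critical point of $A$ on $M^0(L)$. Then $R$ is diacyclic: its vertices lie on a circle of positive radius with center $O$, so that $r_0r_n$ is a diameter of it. For $i=1,\dots,n$ put $\varepsilon_i=1$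 if $O$ lies to the left of the oriented edge $r_{i-1}r_i$ and $\varepsilon_i=-1$ if it lies to the right, let $2\alpha_i\in(0,\pi)$ be the unoriented angle between $\overrightarrow{Or_{i-1}}$ and $\overrightarrow{Or_i}$, let $e(R)$ be the number of $i$ with $\varepsilon_i=1$, and let $\delta(R)=\sum_{i=1}^n\varepsilon_i\tan\alpha_i$. A closure of $R$ is a closed polygon $(r_0,\dots,r_n,q)$ with $q$ on the same circle such that $O$ lies strictly to the left of both added edges $r_nq$ and $qr_0$. Closures exist, and if $\omega_R$ is the winding number about $O$ of any closure of $R$, then the Morse index of $A$ at $R$ (the maximal dimension of a subspace on which the Hessian is negative definite) is $$\mu_R(A)=\begin{cases} e(R)-2\omega_R+1 & \text{if } \delta(R)>0,\\ e(R)-2\omega_R & \text{otherwise.}\end{cases}$$ -/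

import Mathlib

noncomputable section

namespace RobotArm

/-! Planar robot arms with `n + 1` edges, in the Euclidean plane `ℂ`. The length vector is
`L : Fin (n + 1) → ℝ`; a configuration is its list of vertices `R : Fin (n + 2) → ℂ`, and its
`i`-th edge is the vector from `R i.castSucc` to `R i.succ`. -/

/-- The moduli space `M⁰(L)`: configurations with edge lengths `L` whose first two vertices are
`0` and `(l₁, 0)`. -/
def moduliSpace {n : ℕ} (L : Fin (n + 1) → ℝ) : Set (Fin (n + 2) → ℂ) :=
  {R | (∀ i : Fin (n + 1), dist (R i.castSucc) (R i.succ) = L i) ∧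
    R 0 = 0 ∧ R 1 = (L 0 : ℂ)}

/-- The angle parametrization of the moduli space by `ℝⁿ` (the universal cover of the torus
`(S¹)ⁿ`): the first edge has direction angle `0`, the following ones the angles
`β 0, …, β (n - 1)`. -/
def ofAngles {n : ℕ} (L : Fin (n + 1) → ℝ) (β : Fin n → ℝ) : Fin (n + 2) → ℂ :=
  fun k => ∑ i : Fin (n + 1) with i.castSucc < k,
    (L i : ℂ) * Complex.exp (((Fin.cons 0 β : Fin (n + 1) → ℝ) i : ℂ) * Complex.I)

/-- The angle coordinates, in `(-π, π]`, of a configuration with first edge along the positive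
real axis. -/
def angles {n : ℕ} (R : Fin (n + 2) → ℂ) : Fin n → ℝ :=
  fun k => Complex.arg (R k.succ.succ - R k.succ.castSucc)

/-- Successive vertices of `ofAngles L β` differ by the prescribed edge vectors. -/
theorem ofAngles_succ_sub {n : ℕ} (L : Fin (n + 1) → ℝ) (β : Fin n → ℝ) (i : Fin (n + 1)) :
    ofAngles L β i.succ = ofAngles L β i.castSucc +
      (L i : ℂ) * Complex.exp (((Fin.cons 0 β : Fin (n + 1) → ℝ) i : ℂ) * Complex.I) := by
  unfold ofAngles
  have h : (Finset.univ.filter fun j : Fin (n + 1) => j.castSucc < i.succ) =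
      insert i (Finset.univ.filter fun j : Fin (n + 1) => j.castSucc < i.castSucc) := by
    ext j
    simp only [Finset.mem_filter, Finset.mem_univ, true_and, Finset.mem_insert, Fin.lt_def,
      Fin.val_castSucc, Fin.val_succ, Fin.ext_iff]
    omega
  rw [h, Finset.sum_insert (by simp), add_comm]

theorem ofAngles_zero {n : ℕ} (L : Fin (n + 1) → ℝ) (β : Fin n → ℝ) : ofAngles L β 0 = 0 := by
  simp [ofAngles]

/-- The angle parametrization takes values in the moduli space. -/
theorem ofAngles_mem_moduliSpace {n : ℕ} {L : Fin (n + 1) → ℝ} (hL : ∀ i, 0 < L i)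
    (β : Fin n → ℝ) : ofAngles L β ∈ moduliSpace L := by
  refine ⟨fun i => ?_, ofAngles_zero L β, ?_⟩
  · rw [ofAngles_succ_sub, dist_eq_norm, ← norm_neg]
    simp [Complex.norm_exp_ofReal_mul_I, abs_of_pos (hL i)]
  · have h := ofAngles_succ_sub L β 0
    simpa [ofAngles_zero] using h

/-- Every point of the moduli space is recovered from its angle coordinates. -/
theorem ofAngles_angles {n : ℕ} {L : Fin (n + 1) → ℝ} {R : Fin (n + 2) → ℂ}
    (hR : R ∈ moduliSpace L) : ofAngles L (angles R) = R := by
  obtain ⟨h, h0, h1⟩ := hR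
  funext k
  induction k using Fin.induction with
  | zero => rw [ofAngles_zero, h0]
  | succ i ih =>
    rw [ofAngles_succ_sub, ih]
    induction i using Fin.cases with
    | zero => simp [h0, h1]
    | succ j =>
      rw [← h j.succ, dist_comm, dist_eq_norm, Fin.cons_succ, angles,
        Complex.norm_mul_exp_arg_mul_I]
      ring

/-- The planar cross product. -/
def cross (a b : ℂ) : ℝ := a.re * b.im - a.im * b.re

/-- The oriented area: `2 A(R) = (x₀ y₁ - x₁ y₀) + ⋯ + (xₙ y₀ - x₀ yₙ)`, where the successor of
the last vertex is the first one (addition in `Fin (n + 2)` is cyclic). -/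
def area {n : ℕ} (R : Fin (n + 2) → ℂ) : ℝ := (1 / 2) * ∑ k : Fin (n + 2), cross (R k) (R (k + 1))

/-- The oriented area on the moduli space of `L`, in angle coordinates. -/
def areaInAngles {n : ℕ} (L : Fin (n + 1) → ℝ) (β : Fin n → ℝ) : ℝ := area (ofAngles L β)

/-- `R` is a critical point of the oriented area on the moduli space of `L`. -/
def IsCritical {n : ℕ} (L : Fin (n + 1) → ℝ) (R : Fin (n + 2) → ℂ) : Prop :=
  R ∈ moduliSpace L ∧ fderiv ℝ (areaInAngles L) (angles R) = 0

/-- The Hessian of the oriented area at `R`, in angle coordinates. -/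
def hessian {n : ℕ} (L : Fin (n + 1) → ℝ) (R : Fin (n + 2) → ℂ) :
    LinearMap.BilinForm ℝ (Fin n → ℝ) :=
  (fderiv ℝ (fderiv ℝ (areaInAngles L)) (angles R)).toLinearMap₁₂

/-- The Morse index: the maximal dimension of a subspace on which the Hessian is negative
definite. -/
def morseIndex {n : ℕ} (L : Fin (n + 1) → ℝ) (R : Fin (n + 2) → ℂ) : ℕ :=
  sigNeg (LinearMap.BilinMap.toQuadraticMap (hessian L R))

/-- The midpoint of the connecting side; for a diacyclic configuration this is the center `O` of
the circumscribed circle. -/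
def center {n : ℕ} (R : Fin (n + 2) → ℂ) : ℂ := midpoint ℝ (R 0) (R (Fin.last (n + 1)))

/-- All vertices lie on one circle (of positive radius), and the connecting side is a diameter of
it. -/
def IsDiacyclic {n : ℕ} (R : Fin (n + 2) → ℂ) : Prop :=
  ∃ ρ : ℝ, 0 < ρ ∧ ∀ k, dist (R k) (center R) = ρ

/-- The point `c` lies strictly to the left of the oriented line from `p` to `q`. -/
def IsLeft (c p q : ℂ) : Prop := 0 < cross (q - p) (c - p)

/-- The orientation `εᵢ` of the `i`-th edge: `1` if the center lies to the left of it, `-1` if the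
center lies to the right (and `0` if the edge passes through the center). -/
def edgeSign {n : ℕ} (R : Fin (n + 2) → ℂ) (i : Fin (n + 1)) : ℝ :=
  Real.sign (cross (R i.succ - R i.castSucc) (center R - R i.castSucc))

/-- The angle `αᵢ`: half of the unoriented angle under which the `i`-th edge is seen from the
center. -/
def halfAngle {n : ℕ} (R : Fin (n + 2) → ℂ) (i : Fin (n + 1)) : ℝ :=
  EuclideanGeometry.angle (R i.castSucc) (center R) (R i.succ) / 2

/-- `e(R)`: the number of positively oriented edges. -/
def numPositive {n : ℕ} (R : Fin (n + 2) → ℂ) : ℕ :=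
  {i : Fin (n + 1) | edgeSign R i = 1}.ncard

/-- `δ(R) = ∑ εᵢ tan αᵢ`. -/
def delta {n : ℕ} (R : Fin (n + 2) → ℂ) : ℝ :=
  ∑ i, edgeSign R i * Real.tan (halfAngle R i)

/-- The winding number about `O` of a closed polygon with cyclically ordered vertices `P k`, none
of whose edges passes through `O`: the total oriented angle, in multiples of `2π`, under which the
edges are seen from `O`. -/
def windingNumber {m : ℕ} (P : Fin (m + 1) → ℂ) (O : ℂ) : ℝ :=
  (∑ k : Fin (m + 1), Complex.arg ((P (k + 1) - O) / (P k - O))) / (2 * Real.pi)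

/-- The closed polygon obtained from `R` by adding the vertex `q`, that is, the two edges from the
last vertex of `R` to `q` and from `q` to the first vertex of `R`. -/
def addVertex {n : ℕ} (R : Fin (n + 2) → ℂ) (q : ℂ) : Fin (n + 3) → ℂ :=
  Fin.snoc (α := fun _ => ℂ) R q

/-- `P` is a closure of the diacyclic configuration `R`: a closed polygon inscribed in the same
circle, obtained from `R` by adding two positively oriented edges. -/
def IsClosure {n : ℕ} (R : Fin (n + 2) → ℂ) (P : Fin (n + 3) → ℂ) : Prop :=
  ∃ q : ℂ, P = addVertex R q ∧ dist q (center R) = dist (R 0) (center R) ∧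
    IsLeft (center R) (R (Fin.last (n + 1))) q ∧ IsLeft (center R) q (R 0)

/-- `L` is a generic linkage: the lengths are positive, all critical points of the oriented area
on its moduli space are non-degenerate, and no critical configuration has an edge passing through
the center of its circumscribed circle. -/
def IsGeneric {n : ℕ} (L : Fin (n + 1) → ℝ) : Prop :=
  (∀ i, 0 < L i) ∧ ∀ R : Fin (n + 2) → ℂ, IsCritical L R →
    (hessian L R).Nondegenerate ∧
      ∀ i : Fin (n + 1), center R ∉ affineSpan ℝ {R i.castSucc, R i.succ}

end RobotArm

end

open RobotArm

/-! Write `u_k` for the vector from `O` to the `k`-th vertex and `t_i` for the tangent of half the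
oriented angle under which edge `i` is seen. The angle derivative of the area along an edge is half
the difference of `|u|²` at its ends, so critical means inscribed about `O`, with `r_0r_n` a
diameter.

For the index, a variation `x` of the directions is encoded by complex numbers `z_k` (`IsSweep`).
With `a_k = Re z_k` the Hessian becomes `|u_0|²/2` times the cyclic sum of `t_i (a_i + a_{i+1})² -
(a_{i+1} - a_i)² / t_i`, under the single constraint `∑ t_i (a_i + a_{i+1}) = 0`
(`Regular.secondVariation_self`, `Regular.sum_slope_mul`). Shifting all `a_k` by a common `s`
removes the constraint: it adds an orthogonal line of sign `δ`. The unconstrained cyclic form is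
diagonalized by eliminating vertices. Completing the square merges two edges into one whose slope is
given by tangent addition, so `edgeIndex t = [t > 0] - (2/π) arctan t` is additive up to the sign of
the square split off (`edgeIndex_add`, `exists_chainForm_eq_signed_squares`). Hence the extended
form has `e(R) - (∑ turns)/π` negative squares. The two edges of a closure add `π` to the total
turn, so this number is `e(R) - 2ω + 1`, and the added line accounts for one of them exactly when `δ
< 0`.

Nongeneric lengths are those for which some point of a compact family of angles and unit kernel
vectors satisfies closed conditions; this gives openness. For density, critical configurations are
parametrized by the radius and all central half angles but one. A vanishing `δ` makes the
differential of the resulting length map singular, while diameters lie over hyperplanes; so the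
nongeneric positive lengths form a null set, by Sard's theorem. -/

noncomputable section

namespace RobotArm

/-! ### Sums of signed squares and the signature -/

section Signature

variable {V W M : Type*} [AddCommGroup V] [Module ℝ V] [AddCommGroup W] [Module ℝ W]
  [AddCommGroup M] [Module ℝ M]

/-- The sum of the squares of a list of linear functionals. -/
def sqSum (P : List (Module.Dual ℝ V)) (v : V) : ℝ := (P.map fun l => l v ^ 2).sum

@[simp] theorem sqSum_nil (v : V) : sqSum ([] : List (Module.Dual ℝ V)) v = 0 := rfl

@[simp] theorem sqSum_cons (l : Module.Dual ℝ V) (P : List (Module.Dual ℝ V)) (v : V) :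
    sqSum (l :: P) v = l v ^ 2 + sqSum P v := by simp [sqSum]

theorem sqSum_nonneg (P : List (Module.Dual ℝ V)) (v : V) : 0 ≤ sqSum P v := by
  induction P with
  | nil => simp
  | cons l P ih => rw [sqSum_cons]; positivity

theorem sqSum_eq_zero {P : List (Module.Dual ℝ V)} {v : V} (h : ∀ l ∈ P, l v = 0) :
    sqSum P v = 0 := by
  induction P with
  | nil => simp
  | cons l P ih => simp [h l (by simp), ih fun l' hl' => h l' (by simp [hl'])]

/-- A space on which a difference of sums of squares pulls back to a positive function has at most
as many dimensions as there are positive squares. -/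
theorem finrank_le_length_of_pos [FiniteDimensional ℝ W] (g : W →ₗ[ℝ] V)
    (N P : List (Module.Dual ℝ V)) (h : ∀ w ≠ 0, 0 < sqSum P (g w) - sqSum N (g w)) :
    Module.finrank ℝ W ≤ P.length := by
  -- A vector killed by all functionals of `P` has a nonpositive value, hence is zero; so the
  -- functionals of `P` embed `W` into a space of dimension `P.length`.
  let F : W →ₗ[ℝ] (Fin P.length → ℝ) := LinearMap.pi fun i => (P.get i).comp g
  have hF : Function.Injective F := by
    rw [← LinearMap.ker_eq_bot, LinearMap.ker_eq_bot']
    intro w hw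
    by_contra hne
    have hz : sqSum P (g w) = 0 := sqSum_eq_zero fun l hl => by
      obtain ⟨i, rfl⟩ := List.mem_iff_get.1 hl
      exact congrFun hw i
    have := h w hne
    have := sqSum_nonneg N (g w)
    linarith
  simpa using LinearMap.finrank_le_finrank_of_injective hF

/-- Only the slice `s = 0` matters, so the sign of `d` plays no role here. -/
theorem sigPos_le_length {Q : QuadraticForm ℝ M} [FiniteDimensional ℝ M] {d : ℝ}
    {N P : List (Module.Dual ℝ (M × ℝ))}
    (h : ∀ x s, Q x + d * s ^ 2 = sqSum P (x, s) - sqSum N (x, s)) : sigPos Q ≤ P.length := by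
  obtain ⟨S, hS, hpos⟩ := exists_finrank_eq_sigPos_and_posDef Q
  rw [← hS]
  refine finrank_le_length_of_pos ((LinearMap.inl ℝ M ℝ).comp S.subtype) N P fun w hw => ?_
  have := hpos w hw
  have h2 := h w 0
  simp only [QuadraticMap.restrict_apply] at this
  simp only [LinearMap.comp_apply, LinearMap.inl_apply, Submodule.subtype_apply]
  rw [← h2]; simpa using this

/-- For `d > 0` the added line enlarges a maximal positive subspace by one dimension. -/
theorem sigPos_lt_length {Q : QuadraticForm ℝ M} [FiniteDimensional ℝ M] {d : ℝ} (hd : 0 < d)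
    {N P : List (Module.Dual ℝ (M × ℝ))}
    (h : ∀ x s, Q x + d * s ^ 2 = sqSum P (x, s) - sqSum N (x, s)) : sigPos Q + 1 ≤ P.length := by
  obtain ⟨S, hS, hpos⟩ := exists_finrank_eq_sigPos_and_posDef Q
  have hr : Module.finrank ℝ (S × ℝ) = sigPos Q + 1 := by simp [hS]
  rw [← hr]
  refine finrank_le_length_of_pos (S.subtype.prodMap LinearMap.id) N P ?_
  rintro ⟨w, s⟩ hw
  simp only [LinearMap.prodMap_apply, Submodule.subtype_apply, LinearMap.id_apply]
  rw [← h]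
  have hnn : 0 ≤ d * s ^ 2 := by positivity
  by_cases hw0 : w = 0
  · subst hw0
    have hs : s ≠ 0 := by rintro rfl; exact hw rfl
    simp only [ZeroMemClass.coe_zero, map_zero, zero_add]
    positivity
  · have := hpos w hw0
    simp only [QuadraticMap.restrict_apply] at this
    linarith

/-- The negative index of a nondegenerate form, read off from a presentation of its orthogonal sum
with a line of sign `d` as a minimal signed sum of squares. -/
theorem sigNeg_eq_of_signed_squares {Q : QuadraticForm ℝ M} [FiniteDimensional ℝ M]
    (hQ : sigPos Q + sigNeg Q = Module.finrank ℝ M) {d : ℝ} (hd : d ≠ 0)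
    {N P : List (Module.Dual ℝ (M × ℝ))} (hlen : N.length + P.length = Module.finrank ℝ M + 1)
    (h : ∀ x s, Q x + d * s ^ 2 = sqSum P (x, s) - sqSum N (x, s)) :
    (sigNeg Q : ℝ) = if 0 < d then (N.length : ℝ) else N.length - 1 := by
  have hneg : ∀ x s, (-Q) x + (-d) * s ^ 2 = sqSum N (x, s) - sqSum P (x, s) := fun x s => by
    have := h x s
    simp only [neg_apply]
    linarith
  split_ifs with hpos
  -- The two lengths add up to `sigPos Q + sigNeg Q + 1`, so both inequalities must be equalities.
  · have h1 := sigPos_lt_length hpos h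
    have h2 := sigPos_le_length hneg
    rw [sigPos_neg] at h2
    have : sigNeg Q = N.length := by omega
    rw [this]
  · have h1 := sigPos_le_length h
    have h2 := sigPos_lt_length (neg_pos.2 (lt_of_le_of_ne (not_lt.1 hpos) hd)) hneg
    rw [sigPos_neg] at h2
    have : sigNeg Q + 1 = N.length := by omega
    rw [← this]; push_cast; ring

end Signature

/-! ### Cyclic chains of two-point forms -/

section Chain

variable {V : Type*} [AddCommGroup V] [Module ℝ V]

/-- The two-point form attached to one edge of slope `t`. -/
def edgeForm (t a b : ℝ) : ℝ := t * (a + b) ^ 2 - (b - a) ^ 2 / t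

/-- The sum of the two-point forms along a chain of functionals starting at `B`. -/
def chainForm (v : V) : Module.Dual ℝ V → List (ℝ × Module.Dual ℝ V) → ℝ
  | _, [] => 0
  | B, p :: r => edgeForm p.1 (B v) (p.2 v) + chainForm v p.2 r

/-- The last functional of a chain starting at `B`. -/
def chainEnd : Module.Dual ℝ V → List (ℝ × Module.Dual ℝ V) → Module.Dual ℝ V
  | B, [] => B
  | _, p :: r => chainEnd p.2 r

/-- The contribution of an edge of slope `t` to the index. -/
def edgeIndex (t : ℝ) : ℝ := (if 0 < t then 1 else 0) - 2 / Real.pi * Real.arctan t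

/-- Passing to `-1/t` rotates the half angle by `π/2`; the change of the arctangent cancels the jump
of the indicator. -/
theorem edgeIndex_neg_inv {t : ℝ} (ht : t ≠ 0) : edgeIndex (-t⁻¹) = edgeIndex t := by
  have := Real.pi_ne_zero
  unfold edgeIndex
  rw [Real.arctan_neg]
  rcases lt_or_gt_of_ne ht with h | h
  · rw [Real.arctan_inv_of_neg h, if_pos (by simpa using h), if_neg (by linarith)]
    field_simp; ring
  · have : ¬ 0 < -t⁻¹ := by have := inv_pos.2 h; linarith
    rw [Real.arctan_inv_of_pos h, if_neg this, if_pos h]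
    field_simp; ring

/-- Two edges with opposite angles split off a hyperbolic plane, which has exactly one negative
square. -/
theorem edgeIndex_add_neg {t : ℝ} (ht : t ≠ 0) : edgeIndex t + edgeIndex (-t) = 1 := by
  unfold edgeIndex
  rw [Real.arctan_neg]
  rcases lt_or_gt_of_ne ht with h | h
  · rw [if_neg (by linarith), if_pos (by linarith)]; ring
  · rw [if_pos h, if_neg (by linarith)]; ring

theorem edgeIndex_add_inv {t : ℝ} (ht : t ≠ 0) : edgeIndex t + edgeIndex t⁻¹ = 1 := by
  rw [← edgeIndex_add_neg ht, ← edgeIndex_neg_inv (neg_ne_zero.2 ht)]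
  simp [inv_neg]

/-- The coefficient of the square of the middle variable of two consecutive edges. -/
def middleCoeff (t₁ t₂ : ℝ) : ℝ := t₁ - t₁⁻¹ + (t₂ - t₂⁻¹)

theorem middleCoeff_eq {t₁ t₂ : ℝ} (h₁ : t₁ ≠ 0) (h₂ : t₂ ≠ 0) :
    middleCoeff t₁ t₂ = (t₁ + t₂) * (t₁ * t₂ - 1) / (t₁ * t₂) := by
  unfold middleCoeff; field_simp; ring

/-- The merged slope is the tangent of the summed half angles. The sign of `middleCoeff` accounts
both for the change in the number of positive slopes and for the jump of the arctangent by `π` when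
`t₁ t₂ > 1`. -/
theorem edgeIndex_add {t₁ t₂ : ℝ} (h₁ : t₁ ≠ 0) (h₂ : t₂ ≠ 0) (hs : t₁ + t₂ ≠ 0)
    (hp : t₁ * t₂ ≠ 1) :
    edgeIndex t₁ + edgeIndex t₂ =
      edgeIndex ((t₁ + t₂) / (1 - t₁ * t₂)) + if middleCoeff t₁ t₂ < 0 then 1 else 0 := by
  have hpi := Real.pi_ne_zero
  rw [middleCoeff_eq h₁ h₂]
  unfold edgeIndex
  rcases lt_or_gt_of_ne hp with hp | hp
  · have hd : 0 < 1 - t₁ * t₂ := by linarith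
    rw [← Real.arctan_add hp]
    rcases lt_or_gt_of_ne h₁ with a | a <;> rcases lt_or_gt_of_ne h₂ with b | b
    · have c : (t₁ + t₂) / (1 - t₁ * t₂) < 0 := div_neg_of_neg_of_pos (by linarith) hd
      have e : 0 < (t₁ + t₂) * (t₁ * t₂ - 1) / (t₁ * t₂) :=
        div_pos (mul_pos_of_neg_of_neg (by linarith) (by linarith)) (mul_pos_of_neg_of_neg a b)
      rw [if_neg a.not_gt, if_neg b.not_gt, if_neg c.not_gt, if_neg e.not_gt]; ring
    · rcases lt_or_gt_of_ne hs with s | s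
      · have c : (t₁ + t₂) / (1 - t₁ * t₂) < 0 := div_neg_of_neg_of_pos (by linarith) hd
        have e : (t₁ + t₂) * (t₁ * t₂ - 1) / (t₁ * t₂) < 0 :=
          div_neg_of_pos_of_neg (mul_pos_of_neg_of_neg (by linarith) (by linarith))
            (mul_neg_of_neg_of_pos a b)
        rw [if_neg a.not_gt, if_pos b, if_neg c.not_gt, if_pos e]; ring
      · have c : 0 < (t₁ + t₂) / (1 - t₁ * t₂) := div_pos (by linarith) hd
        have e : 0 < (t₁ + t₂) * (t₁ * t₂ - 1) / (t₁ * t₂) :=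
          div_pos_of_neg_of_neg (mul_neg_of_pos_of_neg (by linarith) (by linarith))
            (mul_neg_of_neg_of_pos a b)
        rw [if_neg a.not_gt, if_pos b, if_pos c, if_neg e.not_gt]; ring
    · rcases lt_or_gt_of_ne hs with s | s
      · have c : (t₁ + t₂) / (1 - t₁ * t₂) < 0 := div_neg_of_neg_of_pos (by linarith) hd
        have e : (t₁ + t₂) * (t₁ * t₂ - 1) / (t₁ * t₂) < 0 :=
          div_neg_of_pos_of_neg (mul_pos_of_neg_of_neg (by linarith) (by linarith))
            (mul_neg_of_pos_of_neg a b)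
        rw [if_pos a, if_neg b.not_gt, if_neg c.not_gt, if_pos e]; ring
      · have c : 0 < (t₁ + t₂) / (1 - t₁ * t₂) := div_pos (by linarith) hd
        have e : 0 < (t₁ + t₂) * (t₁ * t₂ - 1) / (t₁ * t₂) :=
          div_pos_of_neg_of_neg (mul_neg_of_pos_of_neg (by linarith) (by linarith))
            (mul_neg_of_pos_of_neg a b)
        rw [if_pos a, if_neg b.not_gt, if_pos c, if_neg e.not_gt]; ring
    · have c : 0 < (t₁ + t₂) / (1 - t₁ * t₂) := div_pos (by linarith) hd
      have e : (t₁ + t₂) * (t₁ * t₂ - 1) / (t₁ * t₂) < 0 :=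
        div_neg_of_neg_of_pos (mul_neg_of_pos_of_neg (by linarith) (by linarith)) (mul_pos a b)
      rw [if_pos a, if_pos b, if_pos c, if_pos e]; ring
  · have hd : 1 - t₁ * t₂ < 0 := by linarith
    rcases lt_or_gt_of_ne h₁ with a | a
    · have b : t₂ < 0 := by by_contra! b; nlinarith
      have c : 0 < (t₁ + t₂) / (1 - t₁ * t₂) := div_pos_of_neg_of_neg (by linarith) hd
      have e : (t₁ + t₂) * (t₁ * t₂ - 1) / (t₁ * t₂) < 0 :=
        div_neg_of_neg_of_pos (mul_neg_of_neg_of_pos (by linarith) (by linarith))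
          (mul_pos_of_neg_of_neg a b)
      have := Real.arctan_add_eq_sub_pi hp a
      rw [if_neg a.not_gt, if_neg b.not_gt, if_pos c, if_pos e,
        show Real.arctan ((t₁ + t₂) / (1 - t₁ * t₂)) = Real.arctan t₁ + Real.arctan t₂ + Real.pi by
          linarith]
      field_simp; ring
    · have b : 0 < t₂ := by by_contra! b; nlinarith
      have c : (t₁ + t₂) / (1 - t₁ * t₂) < 0 := div_neg_of_pos_of_neg (by linarith) hd
      have e : 0 < (t₁ + t₂) * (t₁ * t₂ - 1) / (t₁ * t₂) :=
        div_pos (mul_pos (by linarith) (by linarith)) (mul_pos a b)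
      have := Real.arctan_add_eq_add_pi hp a
      rw [if_pos a, if_pos b, if_neg c.not_gt, if_neg e.not_gt,
        show Real.arctan ((t₁ + t₂) / (1 - t₁ * t₂)) = Real.arctan t₁ + Real.arctan t₂ - Real.pi by
          linarith]
      field_simp; ring

/-- Completing the square in the middle variable `b`; what remains in `a` and `c` is again a
two-point form. -/
theorem edgeForm_add {t₁ t₂ : ℝ} (h₁ : t₁ ≠ 0) (h₂ : t₂ ≠ 0) (hs : t₁ + t₂ ≠ 0)
    (hp : t₁ * t₂ ≠ 1) (a b c : ℝ) :
    edgeForm t₁ a b + edgeForm t₂ b c =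
      middleCoeff t₁ t₂ *
        (b + (middleCoeff t₁ t₂)⁻¹ * ((t₁ + t₁⁻¹) * a + (t₂ + t₂⁻¹) * c)) ^ 2 +
      edgeForm ((t₁ + t₂) / (1 - t₁ * t₂)) a c := by
  have hp' : t₁ * t₂ - 1 ≠ 0 := sub_ne_zero.2 hp
  have hp'' : 1 - t₁ * t₂ ≠ 0 := sub_ne_zero.2 hp.symm
  rw [middleCoeff_eq h₁ h₂]
  unfold edgeForm
  have : 1 - t₁ * t₂ = -(t₁ * t₂ - 1) := by ring
  rw [this]
  generalize hX : t₁ * t₂ - 1 = X at *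
  field_simp
  rw [← hX]
  ring

theorem mul_eq_sq_sub_sq (x y : ℝ) : x * y = ((x + y) / 2) ^ 2 - ((x - y) / 2) ^ 2 := by ring

/-- A closed chain of `l.length` edges whose total angle is an odd multiple of `π / 2` is a signed
sum of `l.length` squares, and the number of negative ones is additive over the edges. -/
theorem exists_chainForm_eq_signed_squares (l : List (ℝ × Module.Dual ℝ V))
    (B : Module.Dual ℝ V) (hne : ∀ p ∈ l, p.1 ≠ 0) (hend : chainEnd B l = B)
    (hprod : (l.map fun p => 1 + (p.1 : ℂ) * Complex.I).prod.re = 0) :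
    ∃ N P : List (Module.Dual ℝ V), N.length + P.length = l.length ∧
      (N.length : ℝ) = (l.map fun p => edgeIndex p.1).sum ∧
      ∀ v, chainForm v B l = sqSum P v - sqSum N v := by
  match l with
  -- With fewer than two edges the product has real part `1`.
  | [] => simp at hprod
  | [(t, A)] => simp at hprod
  | (t₁, A₁) :: (t₂, A₂) :: r =>
    have h₁ : t₁ ≠ 0 := hne (t₁, A₁) (by simp)
    have h₂ : t₂ ≠ 0 := hne (t₂, A₂) (by simp)
    have hr : ∀ p ∈ r, p.1 ≠ 0 := fun p hp => hne p (by simp [hp])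
    -- In the two exceptional cases `middleCoeff` vanishes, so `A₁` enters only linearly and no
    -- square can be completed. A product `X * Y` splits off instead, one positive and one negative
    -- square, and two edges disappear.
    by_cases hs : t₁ + t₂ = 0
    · obtain rfl : t₂ = -t₁ := by linarith
      match hr_eq : r with
      | [] =>
        simp at hprod
        nlinarith [sq_nonneg t₁]
      | (t₃, A₃) :: r =>
        have h₃ : t₃ ≠ 0 := hr (t₃, A₃) (by simp)
        have hpos : (1 + t₁ ^ 2 : ℝ) ≠ 0 := by positivity
        obtain ⟨N, P, hlen, hN, h⟩ := exists_chainForm_eq_signed_squares ((t₃, A₃) :: r) B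
          (fun p hp => hr p hp) hend (by
            have : (List.map (fun p : ℝ × Module.Dual ℝ V => 1 + (p.1 : ℂ) * Complex.I)
                ((t₁, A₁) :: (-t₁, A₂) :: (t₃, A₃) :: r)).prod = ((1 + t₁ ^ 2 : ℝ) : ℂ) *
                (List.map (fun p : ℝ × Module.Dual ℝ V => 1 + (p.1 : ℂ) * Complex.I)
                ((t₃, A₃) :: r)).prod := by
              simp only [List.map_cons, List.prod_cons]
              push_cast
              linear_combination (-(t₁ : ℂ) ^ 2) * Complex.I_sq * ((1 + (t₃ : ℂ) * Complex.I) *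
                (r.map fun p => 1 + (p.1 : ℂ) * Complex.I).prod)
            rw [this, Complex.re_ofReal_mul] at hprod
            exact (mul_eq_zero.1 hprod).resolve_left hpos)
        -- On `X = 0` the first two edges cancel and the third starts at `B`; `Y` is the cofactor of
        -- `X` in the difference.
        let X : Module.Dual ℝ V := A₂ - B
        let Y : Module.Dual ℝ V := (t₁⁻¹ - t₁) • (A₂ + B) - (2 * (t₁ + t₁⁻¹)) • A₁ +
          ((t₃ - t₃⁻¹) • (A₂ + B) + (2 * (t₃ + t₃⁻¹)) • A₃)
        refine ⟨(2⁻¹ : ℝ) • (X - Y) :: N, (2⁻¹ : ℝ) • (X + Y) :: P, ?_, ?_, fun v => ?_⟩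
        · simp only [List.length_cons] at *; omega
        · have := edgeIndex_add_neg h₁
          simp only [List.length_cons, List.map_cons, List.sum_cons] at *
          push_cast
          linarith
        · have := h v
          have hXY := mul_eq_sq_sub_sq (X v) (Y v)
          have hG : edgeForm t₁ (B v) (A₁ v) + edgeForm (-t₁) (A₁ v) (A₂ v) +
              edgeForm t₃ (A₂ v) (A₃ v) = X v * Y v + edgeForm t₃ (B v) (A₃ v) := by
            simp only [X, Y, edgeForm, LinearMap.sub_apply, LinearMap.add_apply,
              LinearMap.smul_apply, smul_eq_mul]
            field_simp
            ring
          simp only [chainForm, sqSum_cons, LinearMap.smul_apply, LinearMap.add_apply,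
            LinearMap.sub_apply, smul_eq_mul] at *
          linarith
    · by_cases hp : t₁ * t₂ = 1
      · obtain rfl : t₂ = t₁⁻¹ := eq_inv_of_mul_eq_one_right hp
        match hr_eq : r with
        | [] =>
          -- This is where the recursion ends: a closed pair of edges with total half angle `±π/2`.
          simp only [chainEnd] at hend
          subst hend
          let X : Module.Dual ℝ V := A₂
          let Y : Module.Dual ℝ V := (4 * (t₁ + t₁⁻¹)) • A₁
          refine ⟨[(2⁻¹ : ℝ) • (X - Y)], [(2⁻¹ : ℝ) • (X + Y)], rfl, ?_, fun v => ?_⟩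
          · have := edgeIndex_add_inv h₁
            simp only [List.length_cons, List.map_cons, List.sum_cons, List.length_nil,
              List.map_nil, List.sum_nil] at *
            push_cast
            linarith
          · have hXY := mul_eq_sq_sub_sq (X v) (Y v)
            have hG : edgeForm t₁ (A₂ v) (A₁ v) + edgeForm t₁⁻¹ (A₁ v) (A₂ v) = X v * Y v := by
              simp only [X, Y, edgeForm, LinearMap.smul_apply, smul_eq_mul]
              field_simp
              ring
            simp only [chainForm, sqSum_cons, sqSum_nil, LinearMap.smul_apply,
              LinearMap.add_apply, LinearMap.sub_apply, smul_eq_mul] at *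
            linarith
        | (t₃, A₃) :: r =>
          have h₃ : t₃ ≠ 0 := hr (t₃, A₃) (by simp)
          -- `(1 + it₁)(1 + i/t₁)` is `i` times a real number, and `i(1 + it₃) = -t₃(1 - i/t₃)`: the
          -- quarter turn is absorbed by replacing `t₃` with `-1/t₃`.
          have hc : (-(t₁ + t₁⁻¹) * t₃ : ℝ) ≠ 0 := mul_ne_zero (neg_ne_zero.2 hs) h₃
          obtain ⟨N, P, hlen, hN, h⟩ := exists_chainForm_eq_signed_squares ((-t₃⁻¹, A₃) :: r) B
            (fun p hp => by
              rcases List.mem_cons.1 hp with rfl | hp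
              · simpa using h₃
              · exact hr p (by simp [hp])) hend (by
              have : (List.map (fun p : ℝ × Module.Dual ℝ V => 1 + (p.1 : ℂ) * Complex.I)
                  ((t₁, A₁) :: (t₁⁻¹, A₂) :: (t₃, A₃) :: r)).prod =
                  ((-(t₁ + t₁⁻¹) * t₃ : ℝ) : ℂ) *
                  (List.map (fun p : ℝ × Module.Dual ℝ V => 1 + (p.1 : ℂ) * Complex.I)
                  ((-t₃⁻¹, A₃) :: r)).prod := by
                have h₁' : (t₁ : ℂ) ≠ 0 := by exact_mod_cast h₁
                have h₃' : (t₃ : ℂ) ≠ 0 := by exact_mod_cast h₃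
                simp only [List.map_cons, List.prod_cons]
                rw [← mul_assoc, ← mul_assoc, ← mul_assoc]
                congr 1
                push_cast
                field_simp
                ring_nf
                simp only [Complex.I_sq, show Complex.I ^ 3 = -Complex.I from Complex.I_pow_three]
                ring
              rw [this, Complex.re_ofReal_mul] at hprod
              exact (mul_eq_zero.1 hprod).resolve_left hc)
          -- On `X = 0` the first two edges cancel and the third starts at `-B`; changing the sign
          -- of one endpoint amounts to replacing the slope by `-1/t₃`.
          let X : Module.Dual ℝ V := A₂ + B
          let Y : Module.Dual ℝ V := (t₁ - t₁⁻¹) • (B - A₂) + (2 * (t₁ + t₁⁻¹)) • A₁ +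
            ((t₃ - t₃⁻¹) • (A₂ - B) + (2 * (t₃ + t₃⁻¹)) • A₃)
          refine ⟨(2⁻¹ : ℝ) • (X - Y) :: N, (2⁻¹ : ℝ) • (X + Y) :: P, ?_, ?_, fun v => ?_⟩
          · simp only [List.length_cons] at *; omega
          · have := edgeIndex_add_inv h₁
            have h4 := edgeIndex_neg_inv h₃
            simp only [List.length_cons, List.map_cons, List.sum_cons] at *
            push_cast
            linarith
          · have := h v
            have hXY := mul_eq_sq_sub_sq (X v) (Y v)
            have hG : edgeForm t₁ (B v) (A₁ v) + edgeForm t₁⁻¹ (A₁ v) (A₂ v) +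
                edgeForm t₃ (A₂ v) (A₃ v) = X v * Y v + edgeForm (-t₃⁻¹) (B v) (A₃ v) := by
              simp only [X, Y, edgeForm, LinearMap.sub_apply, LinearMap.add_apply,
                LinearMap.smul_apply, smul_eq_mul]
              field_simp
              ring
            simp only [chainForm, sqSum_cons, LinearMap.smul_apply, LinearMap.add_apply,
              LinearMap.sub_apply, smul_eq_mul] at *
            linarith
      · have hp' : (1 - t₁ * t₂ : ℝ) ≠ 0 := sub_ne_zero.2 (Ne.symm hp)
        obtain ⟨N, P, hlen, hN, h⟩ := exists_chainForm_eq_signed_squares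
          (((t₁ + t₂) / (1 - t₁ * t₂), A₂) :: r) B
          (fun p hp => by
            rcases List.mem_cons.1 hp with rfl | hp
            · exact div_ne_zero hs hp'
            · exact hr p hp) hend (by
            have : (List.map (fun p : ℝ × Module.Dual ℝ V => 1 + (p.1 : ℂ) * Complex.I)
                ((t₁, A₁) :: (t₂, A₂) :: r)).prod = ((1 - t₁ * t₂ : ℝ) : ℂ) *
                (List.map (fun p : ℝ × Module.Dual ℝ V => 1 + (p.1 : ℂ) * Complex.I)
                (((t₁ + t₂) / (1 - t₁ * t₂), A₂) :: r)).prod := by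
              have hp'' : (1 - t₁ * t₂ : ℂ) ≠ 0 := by exact_mod_cast hp'
              simp only [List.map_cons, List.prod_cons]
              rw [← mul_assoc, ← mul_assoc]
              congr 1
              push_cast
              field_simp
              linear_combination (t₁ * t₂ : ℂ) * Complex.I_sq
            rw [this, Complex.re_ofReal_mul] at hprod
            exact (mul_eq_zero.1 hprod).resolve_left hp')
        have hidx := edgeIndex_add h₁ h₂ hs hp
        let Z : Module.Dual ℝ V :=
          A₁ + (middleCoeff t₁ t₂)⁻¹ • ((t₁ + t₁⁻¹) • B + (t₂ + t₂⁻¹) • A₂)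
        have hG : ∀ v, edgeForm t₁ (B v) (A₁ v) + edgeForm t₂ (A₁ v) (A₂ v) =
            middleCoeff t₁ t₂ * Z v ^ 2 +
              edgeForm ((t₁ + t₂) / (1 - t₁ * t₂)) (B v) (A₂ v) := fun v => by
          rw [edgeForm_add h₁ h₂ hs hp]
          simp only [Z, LinearMap.add_apply, LinearMap.smul_apply, smul_eq_mul]
        by_cases hκ : middleCoeff t₁ t₂ < 0
        · refine ⟨√(-middleCoeff t₁ t₂) • Z :: N, P, ?_, ?_, fun v => ?_⟩
          · simp only [List.length_cons] at *; omega
          · rw [if_pos hκ] at hidx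
            simp only [List.length_cons, List.map_cons, List.sum_cons] at *
            push_cast
            linarith
          · have := h v
            have h3 := hG v
            simp only [chainForm, sqSum_cons, LinearMap.smul_apply, smul_eq_mul, mul_pow] at *
            rw [Real.sq_sqrt (by linarith)]
            linarith
        · refine ⟨N, √(middleCoeff t₁ t₂) • Z :: P, ?_, ?_, fun v => ?_⟩
          · simp only [List.length_cons] at *; omega
          · rw [if_neg hκ] at hidx
            simp only [List.map_cons, List.sum_cons] at *
            linarith
          · have := h v
            have h3 := hG v
            simp only [chainForm, sqSum_cons, LinearMap.smul_apply, smul_eq_mul, mul_pow] at *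
            rw [Real.sq_sqrt (by linarith)]
            linarith
termination_by l.length
decreasing_by all_goals (subst_vars; simp only [List.length_cons]; omega)

end Chain

/-! ### The area in angle coordinates and its derivatives -/

section Area

variable {n : ℕ}

/-- The `i`-th edge vector of a configuration. -/
def edge (R : Fin (n + 2) → ℂ) (i : Fin (n + 1)) : ℂ := R i.succ - R i.castSucc

theorem cross_sub_left (a b c : ℂ) : cross (a - b) c = cross a c - cross b c := by
  simp [cross]; ring

theorem cross_add_right (a b c : ℂ) : cross a (b + c) = cross a b + cross a c := by
  simp [cross]; ring

theorem cross_sub_right (a b c : ℂ) : cross a (b - c) = cross a b - cross a c := by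
  simp [cross]; ring

theorem cross_self (a : ℂ) : cross a a = 0 := by simp [cross]; ring

theorem cross_swap (a b : ℂ) : cross a b = -cross b a := by simp [cross]; ring

theorem cross_sum_left {ι : Type*} (s : Finset ι) (f : ι → ℂ) (c : ℂ) :
    cross (∑ i ∈ s, f i) c = ∑ i ∈ s, cross (f i) c := by
  simp [cross, Complex.re_sum, Complex.im_sum, Finset.sum_mul, Finset.sum_sub_distrib]

theorem cross_sum_right {ι : Type*} (s : Finset ι) (f : ι → ℂ) (c : ℂ) :
    cross c (∑ i ∈ s, f i) = ∑ i ∈ s, cross c (f i) := by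
  simp [cross, Complex.re_sum, Complex.im_sum, Finset.mul_sum, Finset.sum_sub_distrib]

theorem cross_real_mul_left (r : ℝ) (a b : ℂ) : cross (r * a) b = r * cross a b := by
  simp [cross]; ring

theorem cross_real_mul_right (r : ℝ) (a b : ℂ) : cross a (r * b) = r * cross a b := by
  simp [cross]; ring

theorem sum_edge_lt (R : Fin (n + 2) → ℂ) (k : Fin (n + 2)) :
    ∑ i : Fin (n + 1) with i.castSucc < k, edge R i = R k - R 0 := by
  induction k using Fin.induction with
  | zero => simp
  | succ k ih =>
    have h : (Finset.univ.filter fun j : Fin (n + 1) => j.castSucc < k.succ) =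
        insert k (Finset.univ.filter fun j : Fin (n + 1) => j.castSucc < k.castSucc) := by
      ext j
      simp only [Finset.mem_filter, Finset.mem_univ, true_and, Finset.mem_insert, Fin.lt_def,
        Fin.val_castSucc, Fin.val_succ, Fin.ext_iff]
      omega
    rw [h, Finset.sum_insert (by simp), ih, edge]
    ring

theorem sum_edge_Iio (R : Fin (n + 2) → ℂ) (k : Fin (n + 1)) :
    ∑ i ∈ Finset.Iio k, edge R i = R k.castSucc - R 0 := by
  rw [← sum_edge_lt]
  congr 1
  ext j; simp

theorem sum_edge_univ (R : Fin (n + 2) → ℂ) :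
    ∑ i, edge R i = R (Fin.last (n + 1)) - R 0 := by
  rw [← sum_edge_lt]
  congr 1
  ext j; simp [Fin.castSucc_lt_last]

theorem sum_eq_Iio_add_Ioi {M : Type*} [AddCommMonoid M] (f : Fin (n + 1) → M)
    (k : Fin (n + 1)) :
    ∑ i, f i = ∑ i ∈ Finset.Iio k, f i + f k + ∑ i ∈ Finset.Ioi k, f i := by
  have h : (Finset.univ : Finset (Fin (n + 1))) =
      (insert k (Finset.Iio k)).disjUnion (Finset.Ioi k) (by
        rw [Finset.disjoint_left]; intro a; simp only [Finset.mem_insert, Finset.mem_Iio,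
          Finset.mem_Ioi]; grind) := by
    ext a
    simp only [Finset.mem_univ, Finset.disjUnion_eq_union, Finset.mem_union, Finset.mem_insert,
      Finset.mem_Iio, Finset.mem_Ioi, true_iff]
    grind
  rw [h, Finset.sum_disjUnion, Finset.sum_insert (by simp), add_comm (f k)]

theorem sum_edge_Ioi (R : Fin (n + 2) → ℂ) (k : Fin (n + 1)) :
    ∑ i ∈ Finset.Ioi k, edge R i = R (Fin.last (n + 1)) - R k.succ := by
  have h := sum_eq_Iio_add_Ioi (edge R) k
  rw [sum_edge_univ, sum_edge_Iio, edge] at h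
  linear_combination -h

theorem area_eq (R : Fin (n + 2) → ℂ) (h0 : R 0 = 0) :
    area R = (1 / 2) * ∑ k, ∑ i ∈ Finset.Iio k, cross (edge R i) (edge R k) := by
  rw [area, Fin.sum_univ_castSucc, Fin.last_add_one, h0]
  have : cross (R (Fin.last (n + 1))) 0 = 0 := by simp [cross]
  rw [this, add_zero]
  congr 1
  refine Finset.sum_congr rfl fun k _ => ?_
  rw [Fin.coeSucc_eq_succ, ← cross_sum_left, sum_edge_Iio, h0, sub_zero, edge, cross_sub_right,
    cross_self, sub_zero]

theorem edge_ofAngles (L : Fin (n + 1) → ℝ) (β : Fin n → ℝ) (i : Fin (n + 1)) :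
    edge (ofAngles L β) i =
      (L i : ℂ) * Complex.exp (((Fin.cons 0 β : Fin (n + 1) → ℝ) i : ℂ) * Complex.I) := by
  rw [edge, ofAngles_succ_sub, add_sub_cancel_left]

theorem edge_ofAngles_re (L : Fin (n + 1) → ℝ) (β : Fin n → ℝ) (i : Fin (n + 1)) :
    (edge (ofAngles L β) i).re = L i * Real.cos ((Fin.cons 0 β : Fin (n + 1) → ℝ) i) := by
  rw [edge_ofAngles, Complex.re_ofReal_mul, Complex.exp_ofReal_mul_I_re]

theorem edge_ofAngles_im (L : Fin (n + 1) → ℝ) (β : Fin n → ℝ) (i : Fin (n + 1)) :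
    (edge (ofAngles L β) i).im = L i * Real.sin ((Fin.cons 0 β : Fin (n + 1) → ℝ) i) := by
  rw [edge_ofAngles, Complex.im_ofReal_mul, Complex.exp_ofReal_mul_I_im]

/-- The direction angle of the `k`-th edge as a linear functional. -/
def angleProj (k : Fin (n + 1)) : (Fin n → ℝ) →L[ℝ] ℝ :=
  Fin.cases 0 (fun j => ContinuousLinearMap.proj j) k

theorem angleProj_apply (k : Fin (n + 1)) (x : Fin n → ℝ) :
    angleProj k x = (Fin.cons 0 x : Fin (n + 1) → ℝ) k := by
  cases k using Fin.cases <;> simp [angleProj]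

theorem areaInAngles_eq (L : Fin (n + 1) → ℝ) (β : Fin n → ℝ) :
    areaInAngles L β = (1 / 2) * ∑ k, ∑ i ∈ Finset.Iio k,
      L i * L k * Real.sin ((angleProj k - angleProj i : (Fin n → ℝ) →L[ℝ] ℝ) β) := by
  rw [areaInAngles, area_eq _ (ofAngles_zero L β)]
  simp only [cross, edge_ofAngles_re, edge_ofAngles_im, sub_apply, angleProj_apply, Real.sin_sub]
  congr 1
  refine Finset.sum_congr rfl fun k _ => Finset.sum_congr rfl fun i _ => ?_
  ring

/-- The derivative of the area in angle coordinates. -/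
def areaDeriv (L : Fin (n + 1) → ℝ) (β : Fin n → ℝ) : (Fin n → ℝ) →L[ℝ] ℝ :=
  (1 / 2 : ℝ) • ∑ k : Fin (n + 1), ∑ i ∈ Finset.Iio k,
    (L i * L k * Real.cos ((angleProj k - angleProj i : (Fin n → ℝ) →L[ℝ] ℝ) β)) •
      (angleProj k - angleProj i : (Fin n → ℝ) →L[ℝ] ℝ)

theorem hasFDerivAt_areaInAngles (L : Fin (n + 1) → ℝ) (β : Fin n → ℝ) :
    HasFDerivAt (areaInAngles L) (areaDeriv L β) β := by
  have h : areaInAngles L = fun β => (1 / 2) * ∑ k, ∑ i ∈ Finset.Iio k,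
      L i * L k * Real.sin ((angleProj k - angleProj i : (Fin n → ℝ) →L[ℝ] ℝ) β) :=
    funext fun β => areaInAngles_eq L β
  rw [h]
  refine HasFDerivAt.const_mul (HasFDerivAt.fun_sum fun k _ => HasFDerivAt.fun_sum fun i _ => ?_) _
  rw [mul_smul]
  exact ((angleProj k - angleProj i).hasFDerivAt.sin).const_mul _

theorem fderiv_areaInAngles (L : Fin (n + 1) → ℝ) :
    fderiv ℝ (areaInAngles L) = areaDeriv L :=
  funext fun β => (hasFDerivAt_areaInAngles L β).fderiv

theorem hasFDerivAt_areaDeriv (L : Fin (n + 1) → ℝ) (β : Fin n → ℝ) :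
    HasFDerivAt (areaDeriv L) ((1 / 2 : ℝ) • ∑ k : Fin (n + 1), ∑ i ∈ Finset.Iio k,
      ((L i * L k) • -Real.sin ((angleProj k - angleProj i : (Fin n → ℝ) →L[ℝ] ℝ) β) •
        (angleProj k - angleProj i : (Fin n → ℝ) →L[ℝ] ℝ)).smulRight
          (angleProj k - angleProj i : (Fin n → ℝ) →L[ℝ] ℝ)) β := by
  have h : ∀ k i : Fin (n + 1), HasFDerivAt (fun β : Fin n → ℝ => (L i * L k * Real.cos
      ((angleProj k - angleProj i : (Fin n → ℝ) →L[ℝ] ℝ) β)) •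
        (angleProj k - angleProj i : (Fin n → ℝ) →L[ℝ] ℝ)) _ β := fun k i =>
    (((angleProj k - angleProj i).hasFDerivAt.cos).const_mul (L i * L k)).smul_const
      (angleProj k - angleProj i : (Fin n → ℝ) →L[ℝ] ℝ)
  exact (HasFDerivAt.fun_sum fun k _ => HasFDerivAt.fun_sum fun i _ => h k i).const_smul (1 / 2 : ℝ)

theorem fderiv_fderiv_areaInAngles_apply (L : Fin (n + 1) → ℝ) (β x y : Fin n → ℝ) :
    fderiv ℝ (fderiv ℝ (areaInAngles L)) β x y = -(1 / 2) * ∑ k, ∑ i ∈ Finset.Iio k,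
      cross (edge (ofAngles L β) i) (edge (ofAngles L β) k) *
        ((Fin.cons 0 x : Fin (n + 1) → ℝ) k - (Fin.cons 0 x : Fin (n + 1) → ℝ) i) *
        ((Fin.cons 0 y : Fin (n + 1) → ℝ) k - (Fin.cons 0 y : Fin (n + 1) → ℝ) i) := by
  rw [fderiv_areaInAngles, (hasFDerivAt_areaDeriv L β).fderiv, neg_mul, ← mul_neg,
    ← Finset.sum_neg_distrib]
  simp only [smul_apply, sum_apply, ContinuousLinearMap.smulRight_apply, sub_apply,
    angleProj_apply, smul_eq_mul, ← Finset.sum_neg_distrib]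
  congr 1
  refine Finset.sum_congr rfl fun k _ => Finset.sum_congr rfl fun i _ => ?_
  simp only [cross, edge_ofAngles_re, edge_ofAngles_im, Real.sin_sub]
  ring

/-- Collects the coefficient of each `X k`, which turns sums over pairs into partial sums that
telescope along the polygon. -/
theorem sum_sum_Iio_mul_sub (m : Fin (n + 1) → Fin (n + 1) → ℝ) (X : Fin (n + 1) → ℝ) :
    ∑ k, ∑ i ∈ Finset.Iio k, m i k * (X k - X i) =
      ∑ k, X k * (∑ i ∈ Finset.Iio k, m i k - ∑ j ∈ Finset.Ioi k, m k j) := by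
  have h : ∑ k, ∑ i ∈ Finset.Iio k, m i k * X i = ∑ i, ∑ k ∈ Finset.Ioi i, m i k * X i :=
    Finset.sum_comm' (by simp)
  simp only [mul_sub, Finset.sum_sub_distrib, h]
  simp only [Finset.sum_mul, mul_comm (X _)]

/-- The first variation of the area, in terms of the distances from the vertices to the center. -/
theorem areaDeriv_apply (L : Fin (n + 1) → ℝ) (β x : Fin n → ℝ) :
    areaDeriv L β x = (1 / 2) * ∑ k, (Fin.cons 0 x : Fin (n + 1) → ℝ) k *
      (Complex.normSq (ofAngles L β k.succ - center (ofAngles L β)) -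
        Complex.normSq (ofAngles L β k.castSucc - center (ofAngles L β))) := by
  set R := ofAngles L β with hR
  have hm : ∀ i k, L i * L k * Real.cos ((angleProj k - angleProj i : (Fin n → ℝ) →L[ℝ] ℝ) β) =
      (edge R i).re * (edge R k).re + (edge R i).im * (edge R k).im := fun i k => by
    rw [hR]
    simp only [edge_ofAngles_re, edge_ofAngles_im, sub_apply, angleProj_apply, Real.cos_sub]
    ring
  have h0 : R 0 = 0 := ofAngles_zero L β
  simp only [areaDeriv, smul_apply, sum_apply, sub_apply, angleProj_apply, smul_eq_mul]
  have hm' := hm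
  simp only [sub_apply, angleProj_apply] at hm'
  simp only [hm']
  rw [sum_sum_Iio_mul_sub
    (fun i k => (edge R i).re * (edge R k).re + (edge R i).im * (edge R k).im)]
  congr 1
  refine Finset.sum_congr rfl fun k _ => ?_
  congr 1
  -- The edges before `k` minus those after it sum to `u_k + u_{k+1}`, and the scalar product with
  -- `u_{k+1} - u_k` is a difference of squared norms.
  simp only [Finset.sum_add_distrib, ← Finset.sum_mul, ← Finset.mul_sum, ← Complex.re_sum,
    ← Complex.im_sum, sum_edge_Iio, sum_edge_Ioi]
  simp only [h0, center, midpoint_eq_smul_add, Complex.normSq_apply, edge]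
  simp
  ring

end Area

/-! ### Diacyclic configurations -/

section Spokes

variable {n : ℕ}

/-- The vector from the center to the `k`-th vertex. -/
def spoke (R : Fin (n + 2) → ℂ) (k : Fin (n + 2)) : ℂ := R k - center R

/-- The oriented angle, in `(-π, π]`, under which the `i`-th edge is seen from the center. -/
def turn (R : Fin (n + 2) → ℂ) (i : Fin (n + 1)) : ℝ :=
  Complex.arg (spoke R i.succ / spoke R i.castSucc)

/-- The tangent of half of the oriented angle under which the `i`-th edge is seen. -/
def slope (R : Fin (n + 2) → ℂ) (i : Fin (n + 1)) : ℝ := Real.tan (turn R i / 2)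

theorem spoke_last (R : Fin (n + 2) → ℂ) : spoke R (Fin.last (n + 1)) = -spoke R 0 := by
  simp only [spoke, center, midpoint_eq_smul_add]
  apply Complex.ext <;> simp <;> ring

theorem edge_eq_spoke (R : Fin (n + 2) → ℂ) (i : Fin (n + 1)) :
    edge R i = spoke R i.succ - spoke R i.castSucc := by simp [edge, spoke]

theorem sum_succ_sub_castSucc {M : Type*} [AddCommGroup M] {m : ℕ} (f : Fin (m + 1) → M) :
    ∑ i : Fin m, (f i.succ - f i.castSucc) = f (Fin.last m) - f 0 := by
  have h := (Fin.sum_univ_succ f).symm.trans (Fin.sum_univ_castSucc f)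
  rw [Finset.sum_sub_distrib, sub_eq_sub_iff_add_eq_add, add_comm, h, add_comm]

/-- Each free angle tests one edge. The fixed first edge is covered because all differences
telescope to zero, the first and last spokes being opposite. -/
theorem fderiv_areaInAngles_eq_zero_iff (L : Fin (n + 1) → ℝ) (β : Fin n → ℝ) :
    fderiv ℝ (areaInAngles L) β = 0 ↔ ∀ i : Fin (n + 1),
      Complex.normSq (spoke (ofAngles L β) i.succ) =
        Complex.normSq (spoke (ofAngles L β) i.castSucc) := by
  rw [fderiv_areaInAngles]
  constructor
  · intro h
    have hs : ∀ j : Fin n, Complex.normSq (spoke (ofAngles L β) j.succ.succ) -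
        Complex.normSq (spoke (ofAngles L β) j.succ.castSucc) = 0 := fun j => by
      have h1 := areaDeriv_apply L β (Pi.single j 1)
      rw [h, Fin.sum_univ_succ] at h1
      simp only [Fin.cons_zero, Fin.cons_succ, Pi.single_apply] at h1
      simpa [spoke] using h1
    have ht := sum_succ_sub_castSucc fun k => Complex.normSq (spoke (ofAngles L β) k)
    rw [spoke_last, Complex.normSq_neg, sub_self, Fin.sum_univ_succ,
      Finset.sum_eq_zero fun j _ => hs j, add_zero] at ht
    intro i
    cases i using Fin.cases with
    | zero => linarith
    | succ j => linarith [hs j]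
  · intro h
    ext x
    rw [areaDeriv_apply, Finset.sum_eq_zero fun k _ => ?_]
    · simp
    · have := h k
      simp only [spoke] at this
      rw [this, sub_self, mul_zero]

theorem IsCritical.normSq_spoke {L : Fin (n + 1) → ℝ} {R : Fin (n + 2) → ℂ}
    (hR : IsCritical L R) (k : Fin (n + 2)) :
    Complex.normSq (spoke R k) = Complex.normSq (spoke R 0) := by
  have h := (fderiv_areaInAngles_eq_zero_iff L (angles R)).1 hR.2
  rw [ofAngles_angles hR.1] at h
  induction k using Fin.induction with
  | zero => rfl
  | succ i ih => rw [h, ih]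

theorem edge_ne_zero {L : Fin (n + 1) → ℝ} (hL : ∀ i, 0 < L i) {R : Fin (n + 2) → ℂ}
    (hR : R ∈ moduliSpace L) (i : Fin (n + 1)) : edge R i ≠ 0 := by
  intro h
  have h1 := hR.1 i
  rw [dist_comm, dist_eq_norm, ← edge, h, norm_zero] at h1
  exact (hL i).ne h1

theorem IsCritical.normSq_pos {L : Fin (n + 1) → ℝ} (hL : ∀ i, 0 < L i)
    {R : Fin (n + 2) → ℂ} (hR : IsCritical L R) : 0 < Complex.normSq (spoke R 0) := by
  refine (Complex.normSq_nonneg _).lt_of_ne' fun h => edge_ne_zero hL hR.1 0 ?_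
  rw [edge_eq_spoke, Complex.normSq_eq_zero.1 ((hR.normSq_spoke _).trans h),
    Complex.normSq_eq_zero.1 ((hR.normSq_spoke _).trans h), sub_zero]

theorem IsCritical.isDiacyclic {L : Fin (n + 1) → ℝ} (hL : ∀ i, 0 < L i)
    {R : Fin (n + 2) → ℂ} (hR : IsCritical L R) : IsDiacyclic R := by
  refine ⟨√(Complex.normSq (spoke R 0)), Real.sqrt_pos.2 (hR.normSq_pos hL), fun k => ?_⟩
  rw [← hR.normSq_spoke k, dist_eq_norm, ← spoke, Complex.normSq_eq_norm_sq,
    Real.sqrt_sq (norm_nonneg _)]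

/-- For vertices on a circle about the center, an edge line contains the center exactly when the
edge is a diameter. -/
theorem center_mem_affineSpan_iff {R : Fin (n + 2) → ℂ} {i : Fin (n + 1)} (he : edge R i ≠ 0)
    (hn : Complex.normSq (spoke R i.succ) = Complex.normSq (spoke R i.castSucc)) :
    center R ∈ affineSpan ℝ {R i.castSucc, R i.succ} ↔
      spoke R i.succ + spoke R i.castSucc = 0 := by
  rw [mem_affineSpan_pair_iff_exists_lineMap_eq]
  constructor
  · rintro ⟨r, hr⟩
    rw [AffineMap.lineMap_apply, vsub_eq_sub, vadd_eq_add] at hr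
    have h1 : (r : ℂ) * spoke R i.succ = ((r - 1 : ℝ) : ℂ) * spoke R i.castSucc := by
      simp only [spoke, ← hr, Complex.real_smul]
      push_cast; ring
    -- Comparing norms gives `r² = (r - 1)²`, so the center can only be the midpoint of the edge.
    have h2 := congrArg Complex.normSq h1
    rw [map_mul, map_mul, hn, Complex.normSq_ofReal, Complex.normSq_ofReal] at h2
    have h0 : Complex.normSq (spoke R i.castSucc) ≠ 0 := fun h0 => he (by
      rw [edge_eq_spoke, Complex.normSq_eq_zero.1 (hn.trans h0), Complex.normSq_eq_zero.1 h0,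
        sub_zero])
    have h3 := mul_right_cancel₀ h0 h2
    have h4 : r = 1 / 2 := by linarith
    subst h4
    push_cast at h1
    linear_combination 2 * h1
  · intro h
    refine ⟨1 / 2, ?_⟩
    rw [AffineMap.lineMap_apply, vsub_eq_sub, vadd_eq_add, Complex.real_smul]
    simp only [spoke] at h
    push_cast
    linear_combination (1 / 2 : ℂ) * h

/-- All vertices lie on a circle about the center, and no edge is trivial. -/
structure Inscribed (R : Fin (n + 2) → ℂ) : Prop where
  normSq_spoke : ∀ k, Complex.normSq (spoke R k) = Complex.normSq (spoke R 0)
  normSq_pos : 0 < Complex.normSq (spoke R 0)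
  edge_ne : ∀ i, edge R i ≠ 0

/-- The geometric data of a critical configuration of a generic arm: all vertices lie on a circle
about the center, and no edge is trivial or a diameter. -/
structure Regular (R : Fin (n + 2) → ℂ) : Prop extends Inscribed R where
  add_ne : ∀ i : Fin (n + 1), spoke R i.succ + spoke R i.castSucc ≠ 0

namespace Inscribed

variable {R : Fin (n + 2) → ℂ} (hR : Inscribed R)
include hR

theorem spoke_ne (k : Fin (n + 2)) : spoke R k ≠ 0 := fun h => by
  have := hR.normSq_spoke k
  rw [h, map_zero] at this
  exact hR.normSq_pos.ne this

theorem norm_div (i : Fin (n + 1)) : ‖spoke R i.succ / spoke R i.castSucc‖ = 1 := by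
  have h : Complex.normSq (spoke R i.succ / spoke R i.castSucc) = 1 := by
    rw [map_div₀, hR.normSq_spoke, hR.normSq_spoke i.castSucc, div_self hR.normSq_pos.ne']
  rw [Complex.normSq_eq_norm_sq] at h
  exact (pow_eq_one_iff_of_nonneg (norm_nonneg _) two_ne_zero).1 h

theorem exp_turn (i : Fin (n + 1)) :
    Complex.exp (turn R i * Complex.I) = spoke R i.succ / spoke R i.castSucc := by
  have h := Complex.norm_mul_exp_arg_mul_I (spoke R i.succ / spoke R i.castSucc)
  rwa [hR.norm_div, Complex.ofReal_one, one_mul] at h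

theorem turn_ne_zero (i : Fin (n + 1)) : turn R i ≠ 0 := fun h => by
  have := hR.exp_turn i
  rw [h, Complex.ofReal_zero, zero_mul, Complex.exp_zero, eq_div_iff (hR.spoke_ne _)] at this
  exact hR.edge_ne i (by rw [edge_eq_spoke, ← this]; ring)

/-- The successive rotations carry the first spoke to the last one, which is its negative. -/
theorem prod_exp_turn : ∏ i, Complex.exp (turn R i * Complex.I) = -1 := by
  have h : ∀ k : Fin (n + 2), spoke R 0 * ∏ i : Fin (n + 1) with i.castSucc < k,
      Complex.exp (turn R i * Complex.I) = spoke R k := by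
    intro k
    induction k using Fin.induction with
    | zero => simp
    | succ k ih =>
      have h : (Finset.univ.filter fun j : Fin (n + 1) => j.castSucc < k.succ) =
          insert k (Finset.univ.filter fun j : Fin (n + 1) => j.castSucc < k.castSucc) := by
        ext j
        simp only [Finset.mem_filter, Finset.mem_univ, true_and, Finset.mem_insert, Fin.lt_def,
          Fin.val_castSucc, Fin.val_succ, Fin.ext_iff]
        omega
      rw [h, Finset.prod_insert (by simp), mul_left_comm, ih, hR.exp_turn,
        div_mul_cancel₀ _ (hR.spoke_ne _)]
  have h1 := h (Fin.last (n + 1))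
  rw [Finset.filter_true_of_mem fun i _ => Fin.castSucc_lt_last i, spoke_last] at h1
  exact mul_left_cancel₀ (hR.spoke_ne 0) (by rw [h1]; ring)

end Inscribed

namespace Regular

variable {R : Fin (n + 2) → ℂ} (hR : Regular R)
include hR

theorem turn_lt_pi (i : Fin (n + 1)) : turn R i < Real.pi := by
  refine (Complex.arg_le_pi _).lt_of_ne fun h => ?_
  have := hR.exp_turn i
  rw [turn, h, Complex.exp_pi_mul_I, eq_div_iff (hR.spoke_ne _)] at this
  exact hR.add_ne i (by rw [← this]; ring)

omit hR in
theorem neg_pi_lt_turn (i : Fin (n + 1)) : -Real.pi < turn R i := Complex.neg_pi_lt_arg _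

theorem arctan_slope (i : Fin (n + 1)) : Real.arctan (slope R i) = turn R i / 2 :=
  Real.arctan_tan (by linarith [neg_pi_lt_turn (R := R) i]) (by linarith [hR.turn_lt_pi i])

theorem cos_half_turn_pos (i : Fin (n + 1)) : 0 < Real.cos (turn R i / 2) :=
  Real.cos_pos_of_mem_Ioo
    ⟨by linarith [neg_pi_lt_turn (R := R) i], by linarith [hR.turn_lt_pi i]⟩

theorem slope_ne_zero (i : Fin (n + 1)) : slope R i ≠ 0 := fun h => by
  have := hR.arctan_slope i
  rw [h, Real.arctan_zero] at this
  exact hR.turn_ne_zero i (by linarith)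

theorem slope_pos_iff (i : Fin (n + 1)) : 0 < slope R i ↔ 0 < turn R i := by
  rw [← Real.arctan_pos, hR.arctan_slope]
  constructor <;> intro h <;> linarith

theorem one_add_slope_mul_I (i : Fin (n + 1)) : 1 + (slope R i : ℂ) * Complex.I =
    Complex.exp ((turn R i / 2 : ℝ) * Complex.I) / (Real.cos (turn R i / 2) : ℂ) := by
  have h : (Real.cos (turn R i / 2) : ℂ) ≠ 0 := by exact_mod_cast (hR.cos_half_turn_pos i).ne'
  rw [Complex.exp_mul_I, slope, Real.tan_eq_sin_div_cos, eq_div_iff h]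
  rw [← Complex.ofReal_cos, ← Complex.ofReal_sin]
  push_cast at *
  field_simp

/-- The half-angle form `(1 + it)/(1 - it)` of the rotation `u'/u`. -/
theorem spoke_succ_mul (i : Fin (n + 1)) : spoke R i.succ * (1 - (slope R i : ℂ) * Complex.I) =
    spoke R i.castSucc * (1 + (slope R i : ℂ) * Complex.I) := by
  have h : (Real.cos (turn R i / 2) : ℂ) ≠ 0 := by exact_mod_cast (hR.cos_half_turn_pos i).ne'
  have h1 := hR.exp_turn i
  rw [eq_div_iff (hR.spoke_ne _)] at h1
  have h2 := hR.one_add_slope_mul_I i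
  have h3 : 1 - (slope R i : ℂ) * Complex.I =
      Complex.exp (-((turn R i / 2 : ℝ) * Complex.I)) / (Real.cos (turn R i / 2) : ℂ) := by
    have := congrArg (starRingEnd ℂ) h2
    rw [map_div₀, ← Complex.exp_conj, Complex.conj_ofReal, map_mul, Complex.conj_ofReal,
      Complex.conj_I, mul_neg, map_add, map_one, map_mul, Complex.conj_ofReal, Complex.conj_I] at this
    rw [← this]; ring
  rw [h2, h3, ← h1]
  have h4 : Complex.exp (turn R i * Complex.I) * Complex.exp (-((turn R i / 2 : ℝ) * Complex.I)) =
      Complex.exp ((turn R i / 2 : ℝ) * Complex.I) := by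
    rw [← Complex.exp_add]; congr 1; push_cast; ring
  rw [← h4]
  ring

theorem cross_edge (i : Fin (n + 1)) : cross (R i.succ - R i.castSucc) (center R - R i.castSucc) =
    Complex.normSq (spoke R 0) * Real.sin (turn R i) := by
  have h1 := hR.exp_turn i
  rw [eq_div_iff (hR.spoke_ne _)] at h1
  have h2 : R i.succ - R i.castSucc = spoke R i.succ - spoke R i.castSucc := by simp [spoke]
  have h3 : center R - R i.castSucc = -spoke R i.castSucc := by simp [spoke]
  rw [h2, h3, ← h1, ← hR.normSq_spoke i.castSucc, Complex.exp_mul_I, ← Complex.ofReal_cos,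
    ← Complex.ofReal_sin]
  simp only [cross, Complex.normSq_apply, Complex.sub_re, Complex.sub_im, Complex.mul_re,
    Complex.mul_im, Complex.add_re, Complex.add_im, Complex.neg_re, Complex.neg_im,
    Complex.ofReal_re, Complex.ofReal_im, Complex.I_re, Complex.I_im]
  ring

theorem edgeSign_eq (i : Fin (n + 1)) : edgeSign R i = if 0 < slope R i then 1 else -1 := by
  rw [edgeSign, hR.cross_edge]
  split_ifs with h
  · exact Real.sign_of_pos (mul_pos hR.normSq_pos
      (Real.sin_pos_of_pos_of_lt_pi ((hR.slope_pos_iff i).1 h) (hR.turn_lt_pi i)))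
  · have h' : turn R i < 0 :=
      (not_lt.1 fun h' => h ((hR.slope_pos_iff i).2 h')).lt_of_ne (hR.turn_ne_zero i)
    exact Real.sign_of_neg (mul_neg_of_pos_of_neg hR.normSq_pos
      (Real.sin_neg_of_neg_of_neg_pi_lt h' (neg_pi_lt_turn i)))

theorem edgeSign_mul_tan (i : Fin (n + 1)) :
    edgeSign R i * Real.tan (halfAngle R i) = slope R i := by
  have h1 : halfAngle R i = |turn R i| / 2 := by
    rw [halfAngle, EuclideanGeometry.angle, vsub_eq_sub, vsub_eq_sub, ← spoke, ← spoke,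
      InnerProductGeometry.angle_comm, Complex.angle_eq_abs_arg (hR.spoke_ne _) (hR.spoke_ne _),
      turn]
  rw [hR.edgeSign_eq, h1, slope]
  split_ifs with h
  · rw [abs_of_pos ((hR.slope_pos_iff i).1 h), one_mul]
  · have h' : turn R i ≤ 0 := not_lt.1 fun h' => h ((hR.slope_pos_iff i).2 h')
    rw [abs_of_nonpos h', neg_div, Real.tan_neg]
    ring

theorem delta_eq : delta R = ∑ i, slope R i :=
  Finset.sum_congr rfl fun i _ => hR.edgeSign_mul_tan i

theorem numPositive_eq : (numPositive R : ℝ) = ∑ i, if 0 < slope R i then 1 else 0 := by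
  rw [Finset.sum_boole, numPositive, ← Set.ncard_coe_finset]
  congr 2
  ext i
  simp only [Set.mem_ofPred_eq, Finset.coe_filter, Finset.mem_univ, true_and, hR.edgeSign_eq]
  split_ifs with h
  · simp [h]
  · simp only [h, iff_false]; norm_num

/-- Up to positive real factors this is the product of the half turns, whose square is `-1`; hence
it is a real multiple of `±i`. -/
theorem prod_one_add_slope_re : (∏ i, (1 + (slope R i : ℂ) * Complex.I)).re = 0 := by
  have h1 : (∏ i, Complex.exp ((turn R i / 2 : ℝ) * Complex.I)) ^ 2 = -1 := by
    rw [← Finset.prod_pow, ← hR.prod_exp_turn]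
    refine Finset.prod_congr rfl fun i _ => ?_
    rw [← Complex.exp_nat_mul]; congr 1; push_cast; ring
  have h2 : (∏ i, Complex.exp ((turn R i / 2 : ℝ) * Complex.I)).re = 0 := by
    generalize ∏ i, Complex.exp ((turn R i / 2 : ℝ) * Complex.I) = z at h1
    have h : (z - Complex.I) * (z + Complex.I) = 0 := by
      linear_combination h1 - Complex.I_sq
    rcases mul_eq_zero.1 h with h | h
    · rw [sub_eq_zero.1 h]; simp
    · rw [eq_neg_of_add_eq_zero_left h]; simp
  simp only [hR.one_add_slope_mul_I, Finset.prod_div_distrib, ← Complex.ofReal_prod]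
  rw [Complex.div_ofReal_re, h2, zero_div]

theorem sum_edgeIndex : ∑ i, edgeIndex (slope R i) =
    numPositive R - (∑ i, turn R i) / Real.pi := by
  rw [hR.numPositive_eq, Finset.sum_div, ← Finset.sum_sub_distrib]
  refine Finset.sum_congr rfl fun i _ => ?_
  rw [edgeIndex, hR.arctan_slope]
  have := Real.pi_ne_zero
  field_simp

end Regular

end Spokes

/-! ### The Hessian at a critical configuration -/

section Hessian

variable {n : ℕ}

/-- The second variation of the area with fixed edge lengths, in terms of the configuration. -/
def secondVariation (R : Fin (n + 2) → ℂ) (x y : Fin n → ℝ) : ℝ :=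
  -(1 / 2) * ∑ k, ∑ i ∈ Finset.Iio k, cross (edge R i) (edge R k) *
    ((Fin.cons 0 x : Fin (n + 1) → ℝ) k - (Fin.cons 0 x : Fin (n + 1) → ℝ) i) *
    ((Fin.cons 0 y : Fin (n + 1) → ℝ) k - (Fin.cons 0 y : Fin (n + 1) → ℝ) i)

theorem hessian_apply {L : Fin (n + 1) → ℝ} {R : Fin (n + 2) → ℂ} (hR : R ∈ moduliSpace L)
    (x y : Fin n → ℝ) : hessian L R x y = secondVariation R x y := by
  have h := fderiv_fderiv_areaInAngles_apply L (angles R) x y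
  rw [ofAngles_angles hR] at h
  exact h

theorem secondVariation_comm (R : Fin (n + 2) → ℂ) (x y : Fin n → ℝ) :
    secondVariation R x y = secondVariation R y x := by
  simp only [secondVariation]
  congr 1
  refine Finset.sum_congr rfl fun k _ => Finset.sum_congr rfl fun i _ => ?_
  ring

theorem hessian_nondegenerate_iff {L : Fin (n + 1) → ℝ} {R : Fin (n + 2) → ℂ}
    (hR : R ∈ moduliSpace L) : (hessian L R).Nondegenerate ↔
      ∀ x, (∀ y, secondVariation R x y = 0) → x = 0 := by
  constructor
  · intro h x hx
    exact h.1 x fun y => by rw [hessian_apply hR, hx]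
  · intro h
    refine ⟨fun x hx => h x fun y => ?_, fun x hx => h x fun y => ?_⟩
    · rw [← hessian_apply hR, hx]
    · rw [secondVariation_comm, ← hessian_apply hR, hx]

/-- `z` describes the variation with velocities `x` of the edge directions, relative to the spokes:
the edge vectors `z' u' - z u` are the velocities of the edges turned by a right angle. -/
def IsSweep (R : Fin (n + 2) → ℂ) (x : Fin n → ℝ) (z : Fin (n + 2) → ℂ) : Prop :=
  z (Fin.last (n + 1)) = z 0 ∧ ∀ i : Fin (n + 1),
    z i.succ * spoke R i.succ - z i.castSucc * spoke R i.castSucc =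
      -Complex.I * ((Fin.cons 0 x : Fin (n + 1) → ℝ) i : ℂ) * edge R i

/-- The sums over earlier and later edges telescope to vertices of `R` and of the polygon `S` with
edges `x_i e_i`; cocircularity then leaves only the increments of `Re z`. -/
theorem Regular.secondVariation_eq {R : Fin (n + 2) → ℂ} (hR : Regular R) {x : Fin n → ℝ}
    {z : Fin (n + 2) → ℂ} (hz : IsSweep R x z) (y : Fin n → ℝ) :
    secondVariation R x y = -Complex.normSq (spoke R 0) *
      ∑ k : Fin (n + 1), (Fin.cons 0 y : Fin (n + 1) → ℝ) k *
        ((z k.succ).re - (z k.castSucc).re) := by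
  set X : Fin (n + 1) → ℝ := Fin.cons 0 x with hX
  set Y : Fin (n + 1) → ℝ := Fin.cons 0 y with hY
  let S : Fin (n + 2) → ℂ := fun k => Complex.I * (z k * spoke R k)
  have hS : ∀ i, edge S i = X i * edge R i := fun i => by
    have h1 : edge S i = Complex.I * (z i.succ * spoke R i.succ -
      z i.castSucc * spoke R i.castSucc) := by simp only [edge, S]; ring
    rw [h1, hz.2 i, ← hX]
    linear_combination (-(X i : ℂ) * edge R i) * Complex.I_sq
  have hSl : S (Fin.last (n + 1)) = -S 0 := by simp only [S, hz.1, spoke_last]; ring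
  rw [secondVariation, sum_sum_Iio_mul_sub (fun i k => cross (edge R i) (edge R k) * (X k - X i)),
    Finset.mul_sum, Finset.mul_sum]
  refine Finset.sum_congr rfl fun k _ => ?_
  have h1 : ∑ i ∈ Finset.Iio k, cross (edge R i) (edge R k) * (X k - X i) =
      X k * cross (R k.castSucc - R 0) (edge R k) - cross (S k.castSucc - S 0) (edge R k) := by
    rw [← sum_edge_Iio R, ← sum_edge_Iio S, cross_sum_left, cross_sum_left, Finset.mul_sum,
      ← Finset.sum_sub_distrib]
    refine Finset.sum_congr rfl fun i _ => ?_
    rw [hS, cross_real_mul_left]; ring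
  have h2 : ∑ j ∈ Finset.Ioi k, cross (edge R k) (edge R j) * (X j - X k) =
      cross (edge R k) (S (Fin.last (n + 1)) - S k.succ) -
        X k * cross (edge R k) (R (Fin.last (n + 1)) - R k.succ) := by
    rw [← sum_edge_Ioi R, ← sum_edge_Ioi S, cross_sum_right, cross_sum_right, Finset.mul_sum,
      ← Finset.sum_sub_distrib]
    refine Finset.sum_congr rfl fun i _ => ?_
    rw [hS, cross_real_mul_right]; ring
  rw [h1, h2, hSl]
  have hc : ∀ a b : Fin (n + 2), R a - R b = spoke R a - spoke R b := fun a b => by simp [spoke]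
  rw [hc, hc, spoke_last]
  set u := spoke R k.castSucc with hu
  set u' := spoke R k.succ with hu'
  have he : edge R k = u' - u := edge_eq_spoke R k
  have hw : z k.succ * u' - z k.castSucc * u = -Complex.I * X k * (u' - u) := by
    rw [← he]; exact hz.2 k
  have hr := hR.normSq_spoke k.castSucc
  have hr' := hR.normSq_spoke k.succ
  -- The second argument is written once as a multiple of `u` and once as the same kind of multiple
  -- of `u'`. Each cross product then reads off one real part, with the common factor `2|u_0|²`.
  have key : cross (u' - u) (S k.castSucc + S k.succ - X k * (u + u')) =
      2 * Complex.normSq (spoke R 0) * ((z k.succ).re - (z k.castSucc).re) := by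
    have e1 : S k.castSucc + S k.succ - X k * (u + u') =
        2 * (Complex.I * (z k.castSucc + Complex.I * X k)) * u := by
      simp only [S, ← hu, ← hu']
      linear_combination Complex.I * hw - 2 * X k * u * Complex.I_sq
        - X k * (u' - u) * Complex.I_sq
    have e2 : 2 * (Complex.I * (z k.castSucc + Complex.I * X k)) * u =
        2 * (Complex.I * (z k.succ + Complex.I * X k)) * u' := by
      linear_combination (-2 * Complex.I) * hw
    have e3 : ∀ a c : ℂ, cross a (2 * (Complex.I * (c + Complex.I * X k)) * a) =
        2 * Complex.normSq a * c.re := fun a c => by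
      simp [cross, Complex.normSq_apply]; ring
    rw [e1, cross_sub_left, e3]
    rw [e2, e3, hr, hr']
    ring
  rw [← he] at key
  rw [cross_sub_right, cross_add_right, cross_real_mul_right, cross_add_right] at key
  rw [cross_swap _ (edge R k), cross_swap _ (edge R k)]
  simp only [cross_sub_right, show ∀ a b : ℂ, cross a (-b) = -cross a b by
    intro a b; simp [cross]; ring]
  linear_combination (-(1 / 2) * Y k) * key

/-- Coordinates of the sweep equation along one edge. -/
theorem Regular.sweep_step {R : Fin (n + 2) → ℂ} (hR : Regular R) (i : Fin (n + 1))
    (z z' : ℂ) (x : ℝ) :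
    z' * spoke R i.succ - z * spoke R i.castSucc = -Complex.I * (x : ℂ) * edge R i ↔
      z'.re - z.re = slope R i * (z.im + z'.im + 2 * x) ∧
        z'.im - z.im = -slope R i * (z.re + z'.re) := by
  have h := hR.spoke_succ_mul i
  rw [edge_eq_spoke]
  set u := spoke R i.castSucc
  set u' := spoke R i.succ
  set t := slope R i
  have hu : u ≠ 0 := hR.spoke_ne _
  have ht : (1 - (t : ℂ) * Complex.I) ≠ 0 := fun h => by
    have := congrArg Complex.re h
    simp at this
  -- Multiplying by `(1 - it)/u` eliminates both spokes.
  have e : z' * u' - z * u = -Complex.I * (x : ℂ) * (u' - u) ↔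
      z' * (1 + t * Complex.I) - z * (1 - t * Complex.I) = 2 * x * t := by
    constructor <;> intro h'
    · apply mul_left_cancel₀ hu
      linear_combination (1 - t * Complex.I) * h' - (z' + Complex.I * x) * h
        - 2 * x * t * u * Complex.I_sq
    · apply mul_right_cancel₀ ht
      linear_combination u * h' + (z' + Complex.I * x) * h + 2 * x * t * u * Complex.I_sq
  rw [e, Complex.ext_iff]
  simp
  constructor
  · rintro ⟨h1, h2⟩; constructor <;> linarith
  · rintro ⟨h1, h2⟩; constructor <;> linarith

end Hessian

/-! ### The Hessian as a constrained cyclic form, its kernel and its index -/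

section Index

variable {n : ℕ}

/-- The linear solution of the sweep equation. -/
def sweep (R : Fin (n + 2) → ℂ) (k : Fin (n + 2)) : (Fin n → ℝ) →ₗ[ℝ] ℂ :=
  (LinearMap.mulLeft ℝ (-Complex.I / spoke R k)).comp
    (∑ i : Fin (n + 1) with i.castSucc < k, (angleProj i).toLinearMap.smulRight (edge R i) -
      (1 / 2 : ℝ) • ∑ i : Fin (n + 1), (angleProj i).toLinearMap.smulRight (edge R i))

theorem sweep_mul_spoke {R : Fin (n + 2) → ℂ} {k : Fin (n + 2)} (hk : spoke R k ≠ 0)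
    (x : Fin n → ℝ) : sweep R k x * spoke R k = -Complex.I *
      (∑ i : Fin (n + 1) with i.castSucc < k, ((Fin.cons 0 x : Fin (n + 1) → ℝ) i : ℂ) * edge R i -
        (1 / 2) * ∑ i : Fin (n + 1), ((Fin.cons 0 x : Fin (n + 1) → ℝ) i : ℂ) * edge R i) := by
  simp only [sweep, LinearMap.comp_apply, LinearMap.mulLeft_apply, LinearMap.sub_apply,
    LinearMap.smul_apply, LinearMap.sum_apply, LinearMap.smulRight_apply,
    ContinuousLinearMap.coe_coe, angleProj_apply, Complex.real_smul]
  push_cast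
  field_simp

/-- Subtracting half of the total sum makes the first and last partial sums opposite; since the
corresponding spokes are opposite too, `z` closes up. -/
theorem Regular.isSweep_sweep {R : Fin (n + 2) → ℂ} (hR : Regular R) (x : Fin n → ℝ) :
    IsSweep R x fun k => sweep R k x := by
  constructor
  · apply mul_right_cancel₀ (hR.spoke_ne 0)
    have h1 := sweep_mul_spoke (hR.spoke_ne (Fin.last (n + 1))) x
    rw [sweep_mul_spoke (hR.spoke_ne 0)]
    rw [Finset.filter_true_of_mem fun i _ => Fin.castSucc_lt_last i, spoke_last] at h1
    rw [Finset.filter_false_of_mem (fun i _ => by simp), Finset.sum_empty]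
    linear_combination -h1
  · intro k
    have h : (Finset.univ.filter fun j : Fin (n + 1) => j.castSucc < k.succ) =
        insert k (Finset.univ.filter fun j : Fin (n + 1) => j.castSucc < k.castSucc) := by
      ext j
      simp only [Finset.mem_filter, Finset.mem_univ, true_and, Finset.mem_insert, Fin.lt_def,
        Fin.val_castSucc, Fin.val_succ, Fin.ext_iff]
      omega
    rw [sweep_mul_spoke (hR.spoke_ne _), sweep_mul_spoke (hR.spoke_ne _), h,
      Finset.sum_insert (by simp)]
    ring

/-- The imaginary parts of `z` close up; this is the only constraint the real parts retain. -/
theorem Regular.sum_slope_mul {R : Fin (n + 2) → ℂ} (hR : Regular R) {x : Fin n → ℝ}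
    {z : Fin (n + 2) → ℂ} (hz : IsSweep R x z) :
    ∑ i : Fin (n + 1), slope R i * ((z i.castSucc).re + (z i.succ).re) = 0 := by
  have h := sum_succ_sub_castSucc fun k => (z k).im
  simp only [hz.1, sub_self] at h
  rw [← neg_eq_zero, ← h, ← Finset.sum_neg_distrib]
  refine Finset.sum_congr rfl fun i _ => ?_
  rw [((hR.sweep_step i _ _ _).1 (hz.2 i)).2]
  ring

/-- The Hessian at a regular critical configuration as a cyclic sum of two-point forms. -/
theorem Regular.secondVariation_self {R : Fin (n + 2) → ℂ} (hR : Regular R) {x : Fin n → ℝ}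
    {z : Fin (n + 2) → ℂ} (hz : IsSweep R x z) :
    secondVariation R x x = Complex.normSq (spoke R 0) / 2 *
      ∑ i : Fin (n + 1), edgeForm (slope R i) (z i.castSucc).re (z i.succ).re := by
  -- Boundary term of the summation by parts that removes the imaginary parts; it vanishes because
  -- `z` is closed.
  have h := sum_succ_sub_castSucc fun k => (z k).re * (z k).im
  simp only [hz.1, sub_self] at h
  rw [hR.secondVariation_eq hz, Finset.mul_sum, Finset.mul_sum]
  have h2 : ∀ i : Fin (n + 1), -Complex.normSq (spoke R 0) *
      ((Fin.cons 0 x : Fin (n + 1) → ℝ) i * ((z i.succ).re - (z i.castSucc).re)) =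
      Complex.normSq (spoke R 0) / 2 * edgeForm (slope R i) (z i.castSucc).re (z i.succ).re +
        Complex.normSq (spoke R 0) *
          ((z i.succ).re * (z i.succ).im - (z i.castSucc).re * (z i.castSucc).im) := fun i => by
    obtain ⟨h3, h4⟩ := (hR.sweep_step i _ _ _).1 (hz.2 i)
    have ht := hR.slope_ne_zero i
    generalize (Fin.cons 0 x : Fin (n + 1) → ℝ) i = X at *
    have hX : X = (((z i.succ).re - (z i.castSucc).re) / slope R i -
        ((z i.castSucc).im + (z i.succ).im)) / 2 := by
      rw [h3]; field_simp; ring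
    rw [hX, edgeForm]
    field_simp
    linear_combination (-Complex.normSq (spoke R 0) * slope R i *
      ((z i.castSucc).re + (z i.succ).re)) * h4
  rw [Finset.sum_congr rfl fun i _ => h2 i, Finset.sum_add_distrib, ← Finset.mul_sum _ _
    (Complex.normSq (spoke R 0)), h, mul_zero, add_zero]

/-- A sweep with constant real part lies in the kernel. With real part `1` the imaginary part drops
by `2 t_i` along edge `i`, so it closes up exactly when `δ = 0`. -/
theorem Regular.secondVariation_degenerate_of_delta_eq_zero {R : Fin (n + 2) → ℂ}
    (hR : Regular R) (hδ : delta R = 0) :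
    ∃ x ≠ 0, ∀ y, secondVariation R x y = 0 := by
  rw [hR.delta_eq, Fin.sum_univ_succ] at hδ
  -- The initial value `slope R 0` makes the velocity of the fixed first edge zero.
  let b : Fin (n + 2) → ℝ := fun k =>
    slope R 0 - 2 * ∑ i : Fin (n + 1) with i.castSucc < k, slope R i
  have hb : ∀ k : Fin (n + 1), b k.succ = b k.castSucc - 2 * slope R k := fun k => by
    have h : (Finset.univ.filter fun j : Fin (n + 1) => j.castSucc < k.succ) =
        insert k (Finset.univ.filter fun j : Fin (n + 1) => j.castSucc < k.castSucc) := by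
      ext j
      simp only [Finset.mem_filter, Finset.mem_univ, true_and, Finset.mem_insert, Fin.lt_def,
        Fin.val_castSucc, Fin.val_succ, Fin.ext_iff]
      omega
    simp only [b]
    rw [h, Finset.sum_insert (by simp)]
    ring
  have hb0 : b 0 = slope R 0 := by simp [b]
  have hbl : b (Fin.last (n + 1)) = b 0 := by
    simp only [b]
    rw [Finset.filter_true_of_mem fun i _ => Fin.castSucc_lt_last i, Fin.sum_univ_succ, hδ]
    simp
  let x : Fin n → ℝ := fun j => -(b j.succ.castSucc + b j.succ.succ) / 2
  have hx : ∀ i, (Fin.cons 0 x : Fin (n + 1) → ℝ) i = -(b i.castSucc + b i.succ) / 2 := fun i => by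
    cases i using Fin.cases with
    | zero => rw [hb, Fin.castSucc_zero, hb0, Fin.cons_zero]; ring
    | succ j => rfl
  have hz : IsSweep R x fun k => ⟨1, b k⟩ := by
    refine ⟨by simp [hbl], fun i => (hR.sweep_step i _ _ _).2 ⟨?_, ?_⟩⟩
    · rw [hx]; simp; ring_nf; simp
    · simp only [hb]; ring
  refine ⟨x, fun h0 => ?_, fun y => ?_⟩
  · have h1 : ∀ i : Fin (n + 1), (⟨1, b i.succ⟩ : ℂ) * spoke R i.succ -
        ⟨1, b i.castSucc⟩ * spoke R i.castSucc = 0 := fun i => by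
      rw [hz.2 i, h0]
      have : (Fin.cons 0 (0 : Fin n → ℝ) : Fin (n + 1) → ℝ) i = 0 := by
        cases i using Fin.cases <;> rfl
      rw [this]; simp
    have h2 := sum_succ_sub_castSucc fun k => (⟨1, b k⟩ : ℂ) * spoke R k
    rw [Finset.sum_eq_zero fun i _ => h1 i, spoke_last, hbl] at h2
    have h3 : (⟨1, b 0⟩ : ℂ) * spoke R 0 = 0 := by linear_combination (1 / 2 : ℂ) * h2
    rcases mul_eq_zero.1 h3 with h4 | h4
    · have := congrArg Complex.re h4
      simp at this
    · exact hR.spoke_ne 0 h4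
  · rw [hR.secondVariation_eq hz]; simp

/-- In the kernel `Re z` is constant, and the constraint forces `2 δ Re z = 0`. Then `Im z` is
constant as well, so `x` is a rigid rotation, excluded by the fixed first edge. -/
theorem Regular.eq_zero_of_secondVariation_eq_zero {R : Fin (n + 2) → ℂ} (hR : Regular R)
    (hδ : delta R ≠ 0) {x : Fin n → ℝ} (hx : ∀ y, secondVariation R x y = 0) : x = 0 := by
  rw [hR.delta_eq] at hδ
  have hz := hR.isSweep_sweep x
  set z : Fin (n + 2) → ℂ := fun k => sweep R k x
  have hs : ∀ j : Fin n, (z j.succ.succ).re - (z j.succ.castSucc).re = 0 := fun j => by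
    have h1 := hR.secondVariation_eq hz (Pi.single j 1)
    rw [hx, Fin.sum_univ_succ] at h1
    simp only [Fin.cons_zero, Fin.cons_succ, Pi.single_apply] at h1
    simpa [hR.normSq_pos.ne'] using h1
  have hs' : ∀ i : Fin (n + 1), (z i.succ).re = (z i.castSucc).re := fun i => by
    cases i using Fin.cases with
    | zero =>
      have ht := sum_succ_sub_castSucc fun k => (z k).re
      rw [hz.1, sub_self, Fin.sum_univ_succ, Finset.sum_eq_zero fun j _ => hs j, add_zero] at ht
      exact sub_eq_zero.1 ht
    | succ j => exact sub_eq_zero.1 (hs j)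
  have hc : ∀ k, (z k).re = (z 0).re := fun k => by
    induction k using Fin.induction with
    | zero => rfl
    | succ i ih => rw [hs', ih]
  have h0 : (z 0).re = 0 := by
    have h := hR.sum_slope_mul hz
    simp only [hc, ← Finset.sum_mul] at h
    have := (mul_eq_zero.1 h).resolve_left hδ
    linarith
  have him : ∀ i : Fin (n + 1), (z i.succ).im = (z i.castSucc).im := fun i => by
    have := ((hR.sweep_step i _ _ _).1 (hz.2 i)).2
    rw [hc, hc i.succ, h0] at this
    linarith
  have hX : ∀ i : Fin (n + 1), (Fin.cons 0 x : Fin (n + 1) → ℝ) i = -(z i.castSucc).im :=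
    fun i => by
      have := ((hR.sweep_step i _ _ _).1 (hz.2 i)).1
      rw [hs', him, sub_self] at this
      have := (mul_eq_zero.1 this.symm).resolve_left (hR.slope_ne_zero i)
      linarith
  have hic : ∀ k, (z k).im = 0 := fun k => by
    induction k using Fin.induction with
    | zero => have := hX 0; rw [Fin.cons_zero, Fin.castSucc_zero] at this; linarith
    | succ i ih => rw [him, ih]
  funext j
  have := hX j.succ
  rw [hic, neg_zero, Fin.cons_succ] at this
  exact this

theorem chainForm_ofFn {V : Type*} [AddCommGroup V] [Module ℝ V] {m : ℕ} (t : Fin m → ℝ)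
    (A : Fin (m + 1) → Module.Dual ℝ V) (v : V) :
    chainForm v (A 0) (List.ofFn fun i => (t i, A i.succ)) =
      ∑ i, edgeForm (t i) (A i.castSucc v) (A i.succ v) := by
  induction m with
  | zero => simp [chainForm]
  | succ m ih =>
    rw [List.ofFn_succ, chainForm, Fin.sum_univ_succ]
    have := ih (fun i => t i.succ) (fun i => A i.succ)
    rw [this]
    rfl

theorem chainEnd_ofFn {V : Type*} [AddCommGroup V] [Module ℝ V] {m : ℕ} (t : Fin m → ℝ)
    (A : Fin (m + 1) → Module.Dual ℝ V) :
    chainEnd (A 0) (List.ofFn fun i => (t i, A i.succ)) = A (Fin.last m) := by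
  induction m with
  | zero => simp [chainEnd]
  | succ m ih =>
    rw [List.ofFn_succ, chainEnd]
    exact ih (fun i => t i.succ) (fun i => A i.succ)

theorem sqSum_map_smul {V : Type*} [AddCommGroup V] [Module ℝ V] (c : ℝ)
    (P : List (Module.Dual ℝ V)) (v : V) : sqSum (P.map fun l => c • l) v = c ^ 2 * sqSum P v := by
  induction P with
  | nil => simp
  | cons l P ih =>
    rw [List.map_cons, sqSum_cons, sqSum_cons, ih, LinearMap.smul_apply, smul_eq_mul]
    ring

theorem Regular.morseIndex_eq {L : Fin (n + 1) → ℝ} {R : Fin (n + 2) → ℂ} (hR : Regular R)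
    (hL : R ∈ moduliSpace L) (hnd : (hessian L R).Nondegenerate) :
    (morseIndex L R : ℝ) = if 0 < delta R then ∑ i, edgeIndex (slope R i)
      else ∑ i, edgeIndex (slope R i) - 1 := by
  have hδ : delta R ≠ 0 := fun h => by
    obtain ⟨x, hx, h⟩ := hR.secondVariation_degenerate_of_delta_eq_zero h
    exact hx ((hessian_nondegenerate_iff hL).1 hnd x h)
  -- The extra coordinate `s` shifts all real parts at once, freeing them from the constraint.
  let A : Fin (n + 2) → Module.Dual ℝ ((Fin n → ℝ) × ℝ) := fun k =>
    (Complex.reLm.comp (sweep R k)).coprod LinearMap.id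
  have hA : ∀ k x s, A k (x, s) = (sweep R k x).re + s := fun k x s => by simp [A]
  have hAl : A (Fin.last (n + 1)) = A 0 := by
    refine LinearMap.ext fun ⟨x, s⟩ => ?_
    rw [hA, hA]
    exact congrArg (fun w : ℂ => w.re + s) (hR.isSweep_sweep x).1
  obtain ⟨N, P, hlen, hN, h⟩ := exists_chainForm_eq_signed_squares
    (List.ofFn fun i => (slope R i, A i.succ)) (A 0)
    (fun p hp => by
      obtain ⟨i, rfl⟩ := (List.mem_ofFn' _ _).1 hp
      exact hR.slope_ne_zero i)
    (by rw [chainEnd_ofFn, hAl])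
    (by rw [List.map_ofFn, List.prod_ofFn]; exact hR.prod_one_add_slope_re)
  rw [List.map_ofFn, List.sum_ofFn] at hN
  rw [List.length_ofFn] at hlen
  have hr := hR.normSq_pos
  set r := Complex.normSq (spoke R 0) with hrdef
  have hc : √(r / 2) ^ 2 = r / 2 := Real.sq_sqrt (by positivity)
  have hform : ∀ x s, LinearMap.BilinMap.toQuadraticMap (hessian L R) x +
      2 * r * delta R * s ^ 2 = sqSum (P.map fun l => √(r / 2) • l) (x, s) -
        sqSum (N.map fun l => √(r / 2) • l) (x, s) := fun x s => by
    have hz := hR.isSweep_sweep x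
    rw [sqSum_map_smul, sqSum_map_smul, hc, ← mul_sub, ← h, chainForm_ofFn,
      LinearMap.BilinMap.toQuadraticMap_apply, hessian_apply hL, hR.secondVariation_self hz,
      ← hrdef]
    -- The part linear in `s` sums to `4s` times the constraint, hence to zero; the part quadratic
    -- in `s` sums to `4 δ s²`.
    have e : ∀ i : Fin (n + 1), edgeForm (slope R i) (A i.castSucc (x, s)) (A i.succ (x, s)) =
        edgeForm (slope R i) (sweep R i.castSucc x).re (sweep R i.succ x).re +
        4 * s * (slope R i * ((sweep R i.castSucc x).re + (sweep R i.succ x).re)) +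
        4 * s ^ 2 * slope R i := fun i => by
      rw [hA, hA, edgeForm, edgeForm]; ring
    rw [Finset.sum_congr rfl fun i _ => e i, Finset.sum_add_distrib, Finset.sum_add_distrib,
      ← Finset.mul_sum, ← Finset.mul_sum, hR.sum_slope_mul hz, hR.delta_eq]
    ring
  have hrad : sigPos (LinearMap.BilinMap.toQuadraticMap (hessian L R)) +
      sigNeg (LinearMap.BilinMap.toQuadraticMap (hessian L R)) =
        Module.finrank ℝ (Fin n → ℝ) := by
    rw [← QuadraticForm.sigPos_add_sigNeg_add_radical
      (Q := LinearMap.BilinMap.toQuadraticMap (hessian L R))]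
    suffices hbot : (LinearMap.BilinMap.toQuadraticMap (hessian L R)).radical = ⊥ by
      rw [hbot, finrank_bot, add_zero]
    rw [Submodule.eq_bot_iff]
    intro x hx
    refine (hessian_nondegenerate_iff hL).1 hnd x fun y => ?_
    obtain ⟨h0, h1⟩ := QuadraticMap.mem_radical_iff'.1 hx
    have h2 := h1 y
    simp only [LinearMap.BilinMap.toQuadraticMap_apply, map_add,
      LinearMap.add_apply, hessian_apply hL] at h0 h2
    rw [secondVariation_comm R y x] at h2
    linarith
  have hd : (2 * r * delta R : ℝ) ≠ 0 := mul_ne_zero (by positivity) hδ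
  rw [morseIndex, sigNeg_eq_of_signed_squares hrad hd (by simpa using hlen) hform]
  have : (0 < 2 * r * delta R) ↔ 0 < delta R := by
    constructor
    · intro h'; exact pos_of_mul_pos_right h' (by positivity)
    · intro h'; positivity
  simp only [this, List.length_map, hN]
  rfl

end Index

/-! ### Closures and the index formula -/

section Closure

variable {n : ℕ}

theorem isLeft_iff (c p q : ℂ) : IsLeft c p q ↔ 0 < cross (p - c) (q - c) := by
  have : cross (q - p) (c - p) = cross (p - c) (q - c) := by simp [cross]; ring
  rw [IsLeft, this]

theorem div_im_pos {p q : ℂ} (h : 0 < cross p q) : 0 < (q / p).im := by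
  have hp : 0 < Complex.normSq p := by
    refine (Complex.normSq_nonneg _).lt_of_ne' fun h0 => ?_
    rw [Complex.normSq_eq_zero.1 h0] at h
    simp [cross] at h
  have : (q / p).im = cross p q / Complex.normSq p := by
    rw [Complex.div_im, cross]; ring
  rw [this]; positivity

theorem arg_neg_inv_of_im_pos {w : ℂ} (h : 0 < w.im) :
    Complex.arg (-w⁻¹) = Real.pi - Complex.arg w := by
  have hw : 0 < Complex.normSq w := Complex.normSq_pos.2 fun h0 => by simp [h0] at h
  have him : (w⁻¹).im < 0 := by
    rw [Complex.inv_im]; exact div_neg_of_neg_of_pos (by linarith) hw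
  have hpi : Complex.arg w ≠ Real.pi := fun h0 => h.ne' (Complex.arg_eq_pi_iff.1 h0).2
  rw [Complex.arg_neg_eq_arg_add_pi_of_im_neg him, Complex.arg_inv, if_neg hpi]
  ring

/-- The two added edges join antipodal points by positive angles `θ` and `π - θ`, whatever `q` is.
-/
theorem windingNumber_of_isClosure {R : Fin (n + 2) → ℂ} {P : Fin (n + 3) → ℂ}
    (hP : IsClosure R P) :
    windingNumber P (center R) = ((∑ i, turn R i) + Real.pi) / (2 * Real.pi) := by
  obtain ⟨q, rfl, -, hl, -⟩ := hP
  rw [isLeft_iff] at hl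
  have hw := div_im_pos hl
  have hc : ∀ k : Fin (n + 2), addVertex R q k.castSucc = R k := fun k => by
    simp [addVertex, Fin.snoc_castSucc (α := fun _ => ℂ)]
  have hlast : addVertex R q (Fin.last (n + 2)) = q := by
    simp [addVertex, Fin.snoc_last (α := fun _ => ℂ)]
  have h0 : addVertex R q 0 = R 0 := hc 0
  have hs : ∀ i : Fin (n + 1), addVertex R q i.castSucc.succ = R i.succ := fun i => by
    rw [Fin.succ_castSucc, hc]
  rw [windingNumber, Fin.sum_univ_castSucc, Fin.sum_univ_castSucc, Fin.last_add_one, h0, hlast]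
  simp only [Fin.coeSucc_eq_succ, hc, hs, Fin.succ_last, hlast]
  have e : (R 0 - center R) / (q - center R) =
      -((q - center R) / (R (Fin.last (n + 1)) - center R))⁻¹ := by
    have := spoke_last R
    simp only [spoke] at this
    rw [inv_div, this, neg_div, neg_neg]
  rw [e, arg_neg_inv_of_im_pos hw]
  simp only [turn, spoke]
  congr 1
  ring

theorem Regular.exists_isClosure {R : Fin (n + 2) → ℂ} (hR : Regular R) :
    ∃ P, IsClosure R P := by
  have hl := spoke_last R
  have hp := hR.normSq_pos
  simp only [spoke] at hl
  rw [spoke] at hp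
  -- The last spoke turned by a quarter turn: the midpoint of the arc from the last vertex to the
  -- first.
  refine ⟨_, center R - Complex.I * (R 0 - center R), rfl, ?_, ?_, ?_⟩
  · rw [dist_eq_norm, dist_eq_norm]; simp
  · rw [isLeft_iff, hl]
    rw [Complex.normSq_apply] at hp
    simp [cross] at *
    linarith
  · rw [isLeft_iff]
    rw [Complex.normSq_apply] at hp
    simp [cross] at *
    linarith

theorem IsCritical.inscribed {L : Fin (n + 1) → ℝ} (hL : ∀ i, 0 < L i) {R : Fin (n + 2) → ℂ}
    (hR : IsCritical L R) : Inscribed R :=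
  ⟨hR.normSq_spoke, hR.normSq_pos hL, edge_ne_zero hL hR.1⟩

theorem IsCritical.regular {L : Fin (n + 1) → ℝ} (hL : ∀ i, 0 < L i) {R : Fin (n + 2) → ℂ}
    (hR : IsCritical L R) (hc : ∀ i : Fin (n + 1), spoke R i.succ + spoke R i.castSucc ≠ 0) :
    Regular R :=
  ⟨hR.inscribed hL, hc⟩

theorem IsCritical.center_mem_iff {L : Fin (n + 1) → ℝ} (hL : ∀ i, 0 < L i)
    {R : Fin (n + 2) → ℂ} (hR : IsCritical L R) (i : Fin (n + 1)) :
    center R ∈ affineSpan ℝ {R i.castSucc, R i.succ} ↔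
      spoke R i.succ + spoke R i.castSucc = 0 :=
  center_mem_affineSpan_iff (edge_ne_zero hL hR.1 i)
    ((hR.normSq_spoke _).trans (hR.normSq_spoke _).symm)

theorem morseIndex_eq_of_isGeneric {L : Fin (n + 1) → ℝ} (hL : IsGeneric L)
    {R : Fin (n + 2) → ℂ} (hR : IsCritical L R) :
    IsDiacyclic R ∧ (∃ P : Fin (n + 3) → ℂ, IsClosure R P) ∧
      ∀ P : Fin (n + 3) → ℂ, IsClosure R P → (morseIndex L R : ℝ) =
        if 0 < delta R then (numPositive R : ℝ) - 2 * windingNumber P (center R) + 1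
        else (numPositive R : ℝ) - 2 * windingNumber P (center R) := by
  obtain ⟨hpos, hgen⟩ := hL
  obtain ⟨hnd, hc⟩ := hgen R hR
  have hreg := hR.regular hpos fun i hi => hc i ((hR.center_mem_iff hpos i).2 hi)
  refine ⟨hR.isDiacyclic hpos, hreg.exists_isClosure, fun P hP => ?_⟩
  rw [hreg.morseIndex_eq hR.1 hnd, hreg.sum_edgeIndex, windingNumber_of_isClosure hP]
  have := Real.pi_ne_zero
  split_ifs <;> field_simp <;> ring

end Closure

/-! ### Genericity is open -/

section Open

variable {n : ℕ}

theorem isCritical_iff {L : Fin (n + 1) → ℝ} {R : Fin (n + 2) → ℂ} :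
    IsCritical L R ↔ R ∈ moduliSpace L ∧ ∀ i : Fin (n + 1),
      Complex.normSq (spoke R i.succ) = Complex.normSq (spoke R i.castSucc) := by
  refine and_congr_right fun hR => ?_
  rw [fderiv_areaInAngles_eq_zero_iff, ofAngles_angles hR]

theorem isClosed_exists_mem_compact {X Y : Type*} [TopologicalSpace X] [TopologicalSpace Y]
    {K : Set X} (hK : IsCompact K) {C : Set (X × Y)} (hC : IsClosed C) :
    IsClosed {y | ∃ x ∈ K, (x, y) ∈ C} := by
  have : CompactSpace K := isCompact_iff_compactSpace.1 hK
  have h := isClosedMap_snd_of_compactSpace (X := K) (Y := Y) _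
    (hC.preimage (f := fun p : K × Y => ((p.1 : X), p.2)) (by fun_prop))
  convert h using 1
  ext y
  simp

theorem continuous_ofAngles (k : Fin (n + 2)) :
    Continuous fun p : (Fin n → ℝ) × (Fin (n + 1) → ℝ) => ofAngles p.2 p.1 k := by
  simp only [ofAngles, ← angleProj_apply]
  fun_prop

theorem continuous_spoke (k : Fin (n + 2)) :
    Continuous fun p : (Fin n → ℝ) × (Fin (n + 1) → ℝ) => spoke (ofAngles p.2 p.1) k := by
  have := continuous_ofAngles (n := n)
  simp only [spoke, center, midpoint_eq_smul_add]
  fun_prop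

theorem isClosed_critical : IsClosed {p : (Fin n → ℝ) × (Fin (n + 1) → ℝ) |
    ∀ i : Fin (n + 1), Complex.normSq (spoke (ofAngles p.2 p.1) i.succ) =
      Complex.normSq (spoke (ofAngles p.2 p.1) i.castSucc)} := by
  rw [Set.ofPred_forall]
  exact isClosed_iInter fun i => isClosed_eq
    (Complex.continuous_normSq.comp (continuous_spoke _))
    (Complex.continuous_normSq.comp (continuous_spoke _))

theorem continuous_secondVariation (y : Fin n → ℝ) :
    Continuous fun p : ((Fin n → ℝ) × (Fin n → ℝ)) × (Fin (n + 1) → ℝ) =>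
      secondVariation (ofAngles p.2 p.1.1) p.1.2 y := by
  have h : ∀ k : Fin (n + 2), Continuous
      fun p : ((Fin n → ℝ) × (Fin n → ℝ)) × (Fin (n + 1) → ℝ) => ofAngles p.2 p.1.1 k :=
    fun k => (continuous_ofAngles k).comp
      (g := fun p : (Fin n → ℝ) × (Fin (n + 1) → ℝ) => ofAngles p.2 p.1 k)
      (f := fun p : ((Fin n → ℝ) × (Fin n → ℝ)) × (Fin (n + 1) → ℝ) => (p.1.1, p.2))
      (by fun_prop)
  have hre : ∀ k : Fin (n + 2), Continuous
      fun p : ((Fin n → ℝ) × (Fin n → ℝ)) × (Fin (n + 1) → ℝ) => (ofAngles p.2 p.1.1 k).re :=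
    fun k => Complex.continuous_re.comp (h k)
  have him : ∀ k : Fin (n + 2), Continuous
      fun p : ((Fin n → ℝ) × (Fin n → ℝ)) × (Fin (n + 1) → ℝ) => (ofAngles p.2 p.1.1 k).im :=
    fun k => Complex.continuous_im.comp (h k)
  simp only [secondVariation, cross, edge, ← angleProj_apply, Complex.sub_re, Complex.sub_im]
  fun_prop

theorem secondVariation_smul (c : ℝ) (R : Fin (n + 2) → ℂ) (x y : Fin n → ℝ) :
    secondVariation R (c • x) y = c * secondVariation R x y := by
  simp only [secondVariation, ← angleProj_apply, map_smul, smul_eq_mul]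
  rw [mul_left_comm]
  congr 1
  rw [Finset.mul_sum]
  refine Finset.sum_congr rfl fun k _ => ?_
  rw [Finset.mul_sum]
  refine Finset.sum_congr rfl fun i _ => ?_
  ring

/-- Genericity as the absence of bad points in a compact family of configurations. -/
theorem isGeneric_iff {L : Fin (n + 1) → ℝ} : IsGeneric L ↔ (∀ i, 0 < L i) ∧
    (∀ i : Fin (n + 1), ¬ ∃ β ∈ Set.Icc (fun _ => -Real.pi) (fun _ : Fin n => Real.pi),
      (∀ i : Fin (n + 1), Complex.normSq (spoke (ofAngles L β) i.succ) =
        Complex.normSq (spoke (ofAngles L β) i.castSucc)) ∧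
      spoke (ofAngles L β) i.succ + spoke (ofAngles L β) i.castSucc = 0) ∧
    ¬ ∃ q ∈ Set.Icc (fun _ => -Real.pi) (fun _ : Fin n => Real.pi) ×ˢ
        Metric.sphere (0 : Fin n → ℝ) 1,
      (∀ i : Fin (n + 1), Complex.normSq (spoke (ofAngles L q.1) i.succ) =
        Complex.normSq (spoke (ofAngles L q.1) i.castSucc)) ∧
      ∀ y, secondVariation (ofAngles L q.1) q.2 y = 0 := by
  refine and_congr_right fun hL => ?_
  constructor
  · intro h
    refine ⟨?_, ?_⟩
    · rintro i ⟨β, -, hcrit, hi⟩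
      have hc := isCritical_iff.2 ⟨ofAngles_mem_moduliSpace hL β, hcrit⟩
      exact (h _ hc).2 i ((hc.center_mem_iff hL i).2 hi)
    · rintro ⟨⟨β, x⟩, ⟨-, hx⟩, hcrit, hy⟩
      have hc := isCritical_iff.2 ⟨ofAngles_mem_moduliSpace hL β, hcrit⟩
      have := (hessian_nondegenerate_iff hc.1).1 (h _ hc).1 x hy
      rw [this] at hx
      simp at hx
  · rintro ⟨h1, h2⟩ R hR
    have hK : angles R ∈ Set.Icc (fun _ => -Real.pi) (fun _ : Fin n => Real.pi) :=
      ⟨fun k => (Complex.neg_pi_lt_arg _).le, fun k => Complex.arg_le_pi _⟩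
    have hcrit := (isCritical_iff.1 hR).2
    have hang := ofAngles_angles hR.1
    refine ⟨(hessian_nondegenerate_iff hR.1).2 fun x hx => ?_, fun i hi => ?_⟩
    · by_contra hne
      -- Kernel vectors can be normalized, which confines them to a compact sphere.
      refine h2 ⟨(angles R, ‖x‖⁻¹ • x), ⟨hK, ?_⟩, ?_, fun y => ?_⟩
      · rw [mem_sphere_zero_iff_norm, norm_smul, norm_inv, norm_norm,
          inv_mul_cancel₀ (norm_ne_zero_iff.2 hne)]
      · simpa only [hang] using hcrit
      · simp only [hang, secondVariation_smul, hx, mul_zero]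
    · refine h1 i ⟨angles R, hK, ?_, ?_⟩
      · rwa [hang]
      · rw [hang]; exact (hR.center_mem_iff hL i).1 hi

/-- Besides positivity, genericity excludes finitely many projections of closed sets along compact
factors. -/
theorem isOpen_isGeneric : IsOpen {L : Fin (n + 1) → ℝ | IsGeneric L} := by
  simp only [isGeneric_iff]
  have hK : IsCompact (Set.Icc (fun _ => -Real.pi) (fun _ : Fin n => Real.pi)) := isCompact_Icc
  refine IsOpen.and ?_ (IsOpen.and ?_ ?_)
  · rw [Set.ofPred_forall]
    exact isOpen_iInter_of_finite fun i => isOpen_lt continuous_const (continuous_apply i)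
  · rw [Set.ofPred_forall]
    refine isOpen_iInter_of_finite fun i => ?_
    exact (isClosed_exists_mem_compact hK (isClosed_critical.inter (isClosed_eq
      ((continuous_spoke i.succ).add (continuous_spoke i.castSucc))
      continuous_const))).isOpen_compl
  · have h2 : IsClosed {p : ((Fin n → ℝ) × (Fin n → ℝ)) × (Fin (n + 1) → ℝ) |
        ∀ y, secondVariation (ofAngles p.2 p.1.1) p.1.2 y = 0} := by
      rw [Set.ofPred_forall]
      exact isClosed_iInter fun y => isClosed_eq (continuous_secondVariation y) continuous_const
    have h1 := (isClosed_critical (n := n)).preimage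
      (f := fun p : ((Fin n → ℝ) × (Fin n → ℝ)) × (Fin (n + 1) → ℝ) => (p.1.1, p.2))
      (by fun_prop)
    exact (isClosed_exists_mem_compact (hK.prod (isCompact_sphere 0 1))
      (h1.inter h2)).isOpen_compl

end Open

/-! ### Genericity is dense -/

section Dense

open MeasureTheory

variable {n : ℕ}

/-- The lengths of a critical configuration as functions of the radius `p 0` and of half of the
central angles of all edges but the first; `s` is a sign. -/
def critLengths (s : ℝ) (p : Fin (n + 1) → ℝ) : Fin (n + 1) → ℝ :=
  Fin.cons (2 * s * p 0 * Real.cos (∑ j : Fin n, p j.succ))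
    fun j : Fin n => 2 * p 0 * Real.sin (p j.succ)

theorem exists_hasFDerivAt_critLengths (s : ℝ) (p : Fin (n + 1) → ℝ) :
    ∃ A : (Fin (n + 1) → ℝ) →L[ℝ] (Fin (n + 1) → ℝ), HasFDerivAt (critLengths s) A p ∧
      ∀ v, A v = Fin.cons (2 * s * (v 0 * Real.cos (∑ j : Fin n, p j.succ) -
          p 0 * Real.sin (∑ j : Fin n, p j.succ) * ∑ j : Fin n, v j.succ))
        fun j : Fin n => 2 * (v 0 * Real.sin (p j.succ) + p 0 * Real.cos (p j.succ) * v j.succ) := by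
  let π : Fin (n + 1) → ((Fin (n + 1) → ℝ) →L[ℝ] ℝ) := fun k => ContinuousLinearMap.proj k
  have hπ : ∀ k, HasFDerivAt (fun p : Fin (n + 1) → ℝ => p k) (π k) p := fun k =>
    (π k).hasFDerivAt
  have hsum : HasFDerivAt (fun p : Fin (n + 1) → ℝ => ∑ j : Fin n, p j.succ)
      (∑ j : Fin n, π j.succ) p := HasFDerivAt.fun_sum fun j _ => hπ j.succ
  have h0 := ((hπ 0).mul hsum.cos).const_mul (2 * s)
  have hj := fun j : Fin n => ((hπ 0).mul (hπ j.succ).sin).const_mul 2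
  refine ⟨ContinuousLinearMap.pi (Fin.cons ((2 * s) • (p 0 • -Real.sin (∑ j : Fin n, p j.succ) •
      ∑ j : Fin n, π j.succ + Real.cos (∑ j : Fin n, p j.succ) • π 0))
    fun j => (2 : ℝ) • (p 0 • Real.cos (p j.succ) • π j.succ + Real.sin (p j.succ) • π 0)),
    hasFDerivAt_pi'.2 fun k => ?_, fun v => ?_⟩
  · cases k using Fin.cases with
    | zero => exact h0.congr_of_eventuallyEq (Filter.Eventually.of_forall fun q => by
        simp [critLengths, mul_assoc])
    | succ j => exact (hj j).congr_of_eventuallyEq (Filter.Eventually.of_forall fun q => by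
        simp [critLengths, mul_assoc])
  · funext k
    cases k using Fin.cases with
    | zero => simp [π]; ring
    | succ j => simp [π]; ring

theorem differentiable_critLengths (s : ℝ) :
    Differentiable ℝ (critLengths (n := n) s) := fun p =>
  let ⟨_, h, _⟩ := exists_hasFDerivAt_critLengths s p
  h.differentiableAt

theorem volume_linear_level (ℓ : (Fin (n + 1) → ℝ) →ₗ[ℝ] ℝ) (hℓ : ℓ ≠ 0) (c : ℝ) :
    volume {p : Fin (n + 1) → ℝ | ℓ p = c} = 0 := by
  let S : AffineSubspace ℝ (Fin (n + 1) → ℝ) :=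
    { carrier := {p | ℓ p = c}
      smul_vsub_vadd_mem' := fun a p₁ p₂ p₃ h₁ h₂ h₃ => by
        simp only [Set.mem_ofPred_eq] at *
        simp [h₁, h₂, h₃] }
  refine Measure.addHaar_affineSubspace volume S fun hS => hℓ ?_
  have h : ∀ p, ℓ p = c := fun p => (hS ▸ AffineSubspace.mem_top ℝ _ p : p ∈ S)
  have h0 := h 0
  rw [map_zero] at h0
  exact LinearMap.ext fun p => by rw [h p, ← h0]; rfl

/-- The parameters where some edge is a diameter or the length map is singular. -/
def badParameters (n : ℕ) (s : ℝ) : Set (Fin (n + 1) → ℝ) :=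
  {p | ∃ j : Fin n, p j.succ = Real.pi / 2} ∪ {p | Real.sin (∑ j : Fin n, p j.succ) = 0} ∪
    {p | (fderiv ℝ (critLengths s) p).det = 0}

/-- Differentiable self-maps of `ℝ^(n+1)` preserve null sets, which handles the hyperplanes; Sard's
theorem handles the singular points. -/
theorem volume_image_badParameters (hn : 1 ≤ n) (s : ℝ) :
    volume (critLengths s '' badParameters n s) = 0 := by
  have hd : ∀ S : Set (Fin (n + 1) → ℝ), volume S = 0 → volume (critLengths s '' S) = 0 :=
    fun S hS => addHaar_image_eq_zero_of_differentiableOn_of_addHaar_eq_zero volume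
      (differentiable_critLengths s).differentiableOn hS
  rw [badParameters, Set.image_union, Set.image_union]
  refine measure_union_null (measure_union_null (hd _ ?_) (hd _ ?_)) ?_
  · rw [Set.ofPred_exists]
    refine measure_iUnion_null fun j => volume_linear_level (LinearMap.proj j.succ) (fun h => ?_) _
    have := LinearMap.congr_fun h (Pi.single j.succ 1)
    simp at this
  · have : {p : Fin (n + 1) → ℝ | Real.sin (∑ j : Fin n, p j.succ) = 0} =
        ⋃ m : ℤ, {p | (∑ j : Fin n, LinearMap.proj j.succ : (Fin (n + 1) → ℝ) →ₗ[ℝ] ℝ) p =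
          m * Real.pi} := by
      ext p
      simp only [Set.mem_ofPred_eq, Real.sin_eq_zero_iff, Set.mem_iUnion, LinearMap.sum_apply,
        LinearMap.proj_apply]
      exact exists_congr fun m => eq_comm
    rw [this]
    refine measure_iUnion_null fun m => volume_linear_level _ (fun h => ?_) _
    -- At the all-ones vector the functional takes the value `n`, nonzero since `1 ≤ n`.
    have := LinearMap.congr_fun h 1
    simp at this
    omega
  · exact addHaar_image_eq_zero_of_det_fderivWithin_eq_zero volume
      (fun p _ => ((differentiable_critLengths s) p).hasFDerivAt.hasFDerivWithinAt)
      fun p hp => hp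

theorem det_fderiv_critLengths_eq_zero {s : ℝ} {p : Fin (n + 1) → ℝ} (hp : p 0 ≠ 0)
    (hs : Real.sin (∑ j : Fin n, p j.succ) ≠ 0) (hc : ∀ j : Fin n, Real.cos (p j.succ) ≠ 0)
    (h : Real.cos (∑ j : Fin n, p j.succ) / Real.sin (∑ j : Fin n, p j.succ) +
      ∑ j : Fin n, Real.tan (p j.succ) = 0) : (fderiv ℝ (critLengths s) p).det = 0 := by
  obtain ⟨A, hA, hv⟩ := exists_hasFDerivAt_critLengths s p
  rw [hA.fderiv]
  by_contra hdet
  let v : Fin (n + 1) → ℝ := Fin.cons (p 0) fun j : Fin n => -Real.tan (p j.succ)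
  have h1 : A v = 0 := by
    rw [hv]
    funext k
    cases k using Fin.cases with
    | zero =>
      have hT : ∑ j : Fin n, Real.tan (p j.succ) = -(Real.cos (∑ j : Fin n, p j.succ) /
        Real.sin (∑ j : Fin n, p j.succ)) := by linarith
      simp only [v, Fin.cons_zero, Fin.cons_succ, Finset.sum_neg_distrib, hT, Pi.zero_apply]
      field_simp
      ring
    | succ j =>
      simp only [v, Fin.cons_zero, Fin.cons_succ, Pi.zero_apply, Real.tan_eq_sin_div_cos]
      have := hc j
      field_simp
      ring
  have h2 : v = 0 := (LinearMap.equivOfDetNeZero (A : (Fin (n + 1) → ℝ) →ₗ[ℝ] (Fin (n + 1) → ℝ))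
    hdet).injective (by rw [map_zero]; exact h1)
  exact hp (congrFun h2 0)

/-- Half of the counterclockwise angle, in `(0, 2π)`, under which the `i`-th edge is seen. -/
def halfArc (R : Fin (n + 2) → ℂ) (i : Fin (n + 1)) : ℝ :=
  turn R i / 2 + if turn R i < 0 then Real.pi else 0

theorem tan_halfArc (R : Fin (n + 2) → ℂ) (i : Fin (n + 1)) :
    Real.tan (halfArc R i) = slope R i := by
  rw [halfArc, slope]
  split_ifs
  · rw [Real.tan_add_pi]
  · rw [add_zero]

theorem Inscribed.norm_edge {R : Fin (n + 2) → ℂ} (hR : Inscribed R) (i : Fin (n + 1)) :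
    ‖edge R i‖ = 2 * √(Complex.normSq (spoke R 0)) * Real.sin (halfArc R i) := by
  have h1 : edge R i = spoke R i.castSucc * (Complex.exp (Complex.I * turn R i) - 1) := by
    rw [mul_comm Complex.I, hR.exp_turn, edge_eq_spoke, mul_sub, mul_div_cancel₀ _ (hR.spoke_ne _),
      mul_one]
  have h2 : ‖spoke R i.castSucc‖ = √(Complex.normSq (spoke R 0)) := by
    rw [← hR.normSq_spoke i.castSucc, Complex.normSq_eq_norm_sq, Real.sqrt_sq (norm_nonneg _)]
  have hlow : -Real.pi < turn R i := Complex.neg_pi_lt_arg _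
  have hup : turn R i ≤ Real.pi := Complex.arg_le_pi _
  have h3 : |Real.sin (turn R i / 2)| = Real.sin (halfArc R i) := by
    rw [halfArc]
    split_ifs with h
    · rw [Real.sin_add_pi, abs_of_neg (Real.sin_neg_of_neg_of_neg_pi_lt (by linarith)
        (by linarith))]
    · rw [add_zero, abs_of_nonneg (Real.sin_nonneg_of_nonneg_of_le_pi (by linarith) (by linarith))]
  rw [h1, norm_mul, h2, Complex.norm_exp_I_mul_ofReal_sub_one, norm_mul, Real.norm_eq_abs,
    Real.norm_eq_abs, h3, abs_of_pos (zero_lt_two' ℝ)]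
  ring

/-- Twice a half arc is the turn modulo `2π`, so the doubled sum is an odd multiple of `π`. This
determines the first half arc from the others, up to the sign `s`. -/
theorem Inscribed.cos_sum_halfArc {R : Fin (n + 2) → ℂ} (hR : Inscribed R) :
    Real.cos (∑ i, halfArc R i) = 0 := by
  have h1 : Complex.exp (((2 * ∑ i, halfArc R i : ℝ) : ℂ) * Complex.I) = -1 := by
    rw [← hR.prod_exp_turn, ← Complex.exp_sum, Finset.mul_sum, Complex.ofReal_sum, Finset.sum_mul,
      Complex.exp_sum, Complex.exp_sum]
    refine Finset.prod_congr rfl fun i _ => ?_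
    rw [halfArc]
    split_ifs
    · rw [show ((2 * (turn R i / 2 + Real.pi) : ℝ) : ℂ) * Complex.I =
        turn R i * Complex.I + 2 * Real.pi * Complex.I by push_cast; ring,
        Complex.exp_periodic]
    · congr 1; push_cast; ring
  have h2 := congrArg Complex.re h1
  rw [Complex.exp_ofReal_mul_I_re, Real.cos_two_mul] at h2
  simp only [Complex.neg_re, Complex.one_re] at h2
  exact pow_eq_zero_iff two_ne_zero |>.1 (by linarith)

/-- Every length vector with a bad critical configuration is a critical or exceptional value of
one of the two length maps. -/
theorem mem_image_badParameters {L : Fin (n + 1) → ℝ} (hL : ∀ i, 0 < L i) (hbad : ¬ IsGeneric L) :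
    L ∈ critLengths 1 '' badParameters n 1 ∪ critLengths (-1) '' badParameters n (-1) := by
  obtain ⟨R, hR, hbad⟩ : ∃ R, IsCritical L R ∧ ¬ ((hessian L R).Nondegenerate ∧
      ∀ i : Fin (n + 1), center R ∉ affineSpan ℝ {R i.castSucc, R i.succ}) := by
    by_contra h
    exact hbad ⟨hL, fun R hR => by_contra fun h' => h ⟨R, hR, h'⟩⟩
  have hI := hR.inscribed hL
  set φ := halfArc R with hφ
  set T := ∑ j : Fin n, φ j.succ with hT
  have hcos : Real.cos (φ 0 + T) = 0 := by
    rw [hT, ← Fin.sum_univ_succ]; exact hI.cos_sum_halfArc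
  have hlen : ∀ i, L i = 2 * √(Complex.normSq (spoke R 0)) * Real.sin (φ i) := fun i => by
    rw [← hI.norm_edge, ← hR.1.1 i, dist_comm, dist_eq_norm, edge]
  have hρ : √(Complex.normSq (spoke R 0)) ≠ 0 := (Real.sqrt_pos.2 hI.normSq_pos).ne'
  set s := Real.sin (φ 0 + T) with hs
  have hs1 : s = 1 ∨ s = -1 := by
    have := Real.sin_sq_add_cos_sq (φ 0 + T)
    rw [hcos] at this
    exact (sq_eq_sq_iff_eq_or_eq_neg.1 (by rw [one_pow]; linarith))
  have hsin0 : Real.sin (φ 0) = s * Real.cos T := by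
    have := Real.sin_sub (φ 0 + T) T
    rw [add_sub_cancel_right, hcos] at this
    linarith
  have hcos0 : Real.cos (φ 0) = s * Real.sin T := by
    have := Real.cos_sub (φ 0 + T) T
    rw [add_sub_cancel_right, hcos] at this
    linarith
  let p : Fin (n + 1) → ℝ := Fin.cons (√(Complex.normSq (spoke R 0))) fun j => φ j.succ
  have hp : critLengths s p = L := by
    funext k
    cases k using Fin.cases with
    | zero =>
      simp only [critLengths, p, Fin.cons_zero, Fin.cons_succ]
      rw [hlen, hsin0]; ring
    | succ j =>
      simp only [critLengths, p, Fin.cons_zero, Fin.cons_succ]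
      rw [hlen]
  suffices hmem : p ∈ badParameters n s by
    rcases hs1 with h | h
    · left; rw [← h]; exact ⟨p, hmem, hp⟩
    · right; rw [← h]; exact ⟨p, hmem, hp⟩
  -- Without diameters, failure of genericity means `δ = 0`, hence a singular differential; a
  -- diameter places the parameters on an exceptional hyperplane.
  by_cases hd : ∀ i : Fin (n + 1), spoke R i.succ + spoke R i.castSucc ≠ 0
  · have hreg := hR.regular hL hd
    have hδ : delta R = 0 := by
      by_contra hδ
      exact hbad ⟨(hessian_nondegenerate_iff hR.1).2 fun x hx =>
        hreg.eq_zero_of_secondVariation_eq_zero hδ hx,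
        fun i hi => hd i ((hR.center_mem_iff hL i).1 hi)⟩
    have hne : ∀ i, Real.cos (φ i) ≠ 0 := fun i h => hreg.slope_ne_zero i (by
      rw [← tan_halfArc, ← hφ, Real.tan_eq_sin_div_cos, h, div_zero])
    right
    have hT0 : Real.sin T ≠ 0 := fun h => hne 0 (by rw [hcos0, h, mul_zero])
    have hs0 : s ≠ 0 := fun h => hne 0 (by rw [hcos0, h, zero_mul])
    refine det_fderiv_critLengths_eq_zero hρ ?_ ?_ ?_
    · exact hT0
    · exact fun j => hne j.succ
    · change Real.cos T / Real.sin T + ∑ j : Fin n, Real.tan (φ j.succ) = 0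
      rw [hreg.delta_eq, Fin.sum_univ_succ] at hδ
      rw [← hδ]
      congr 1
      · rw [← tan_halfArc, ← hφ, Real.tan_eq_sin_div_cos, hsin0, hcos0, mul_div_mul_left _ _ hs0]
      · exact Finset.sum_congr rfl fun j _ => tan_halfArc R j.succ
  · push Not at hd
    obtain ⟨i, hi⟩ := hd
    have hturn : φ i = Real.pi / 2 := by
      have h1 : turn R i = Real.pi := by
        rw [turn, eq_neg_of_add_eq_zero_left hi, neg_div, div_self (hI.spoke_ne _)]
        simp
      rw [hφ, halfArc, h1, if_neg Real.pi_pos.not_gt, add_zero]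
    left
    cases i using Fin.cases with
    | zero =>
      -- The first half arc is not a parameter; its being `π/2` shows up as `sin T = 0`.
      right
      change Real.sin T = 0
      rw [hturn, Real.cos_pi_div_two] at hcos0
      refine (mul_eq_zero.1 hcos0.symm).resolve_left ?_
      rcases hs1 with h | h <;> rw [h] <;> norm_num
    | succ j => left; exact ⟨j, hturn⟩

/-- The complement of a null set is dense, and stays dense within the open cone of positive lengths.
-/
theorem subset_closure_isGeneric (hn : 1 ≤ n) :
    {L : Fin (n + 1) → ℝ | ∀ i, 0 < L i} ⊆ closure {L : Fin (n + 1) → ℝ | IsGeneric L} := by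
  have hnull := measure_union_null (volume_image_badParameters hn 1)
    (volume_image_badParameters hn (-1))
  have hdense : Dense (critLengths 1 '' badParameters n 1 ∪
      critLengths (-1) '' badParameters n (-1))ᶜ :=
    Measure.dense_of_ae (compl_mem_ae_iff.2 hnull)
  have hopen : IsOpen {L : Fin (n + 1) → ℝ | ∀ i, 0 < L i} := by
    rw [Set.ofPred_forall]
    exact isOpen_iInter_of_finite fun i => isOpen_lt continuous_const (continuous_apply i)
  refine (hdense.open_subset_closure_inter hopen).trans (closure_mono ?_)
  rintro L ⟨hL, hN⟩
  by_contra hbad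
  exact hN (mem_image_badParameters hL hbad)

end Dense

end RobotArm

end


theorem theorem6 (n : ℕ) (hn : 1 ≤ n) :
    (IsOpen {L : Fin (n + 1) → ℝ | IsGeneric L} ∧
      {L : Fin (n + 1) → ℝ | ∀ i, 0 < L i} ⊆ closure {L : Fin (n + 1) → ℝ | IsGeneric L}) ∧
    ∀ L : Fin (n + 1) → ℝ, IsGeneric L →
      ∀ R : Fin (n + 2) → ℂ, IsCritical L R →
        IsDiacyclic R ∧ (∃ P : Fin (n + 3) → ℂ, IsClosure R P) ∧
        ∀ P : Fin (n + 3) → ℂ, IsClosure R P →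
          (morseIndex L R : ℝ) =
            if 0 < delta R then (numPositive R : ℝ) - 2 * windingNumber P (center R) + 1
            else (numPositive R : ℝ) - 2 * windingNumber P (center R) :=
  ⟨⟨isOpen_isGeneric, subset_closure_isGeneric hn⟩,
    fun _ hL _ hR => morseIndex_eq_of_isGeneric hL hR⟩
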